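/- Let $r>0$, let $G$ be the distribution function of a probability law on $\mathbb{R}_+=[0,\infty)$, and let $(\tau_i,\xi_i)_{i\ge1}$ be random variables on a probability space $(\Omega,\mathcal F,\mathsf P)$ with $\xi_i\ge 0$ and $\tau_0=0<\tau_1<\tau_2<\dots$. Put $\mathscr G_n=\sigma\{(\tau_i,\xi_i):1\le i\le n\}$ (trivial for $n=0$). Assume that for every $i\ge1$ the variable $\xi_i$ has distribution function $G$ and is independent of $\mathscr G_{i-1}$, that $$\mathsf P(\tau_i\le t\mid\mathscr G_{i-1})=1-e^{-r(t-\tau_{i-1})}\quad\text{on }\{t\ge\tau_{i-1}\},$$ and that, for all $x\ge0$, $$\mathsf P(\xi_i\le x,\ \tau_i\le t\mid\mathscr G_{i-1})=G(x)\bigl(1-e^{-r(t-\tau_{i-1})}\bigr)\quad\text{on }\{t\ge\tau_{i-1}\}.$$ Let $\Lambda=\inf\{\lambda>0:\int_0^\infty e^{\lambda z}\,dG(z)=\infty\}\in[0,\infty]$ (with $\inf\varnothing=\infty$), and for $t>0$ let $$S_t=\frac1t\sum_{i\ge1:\ \tau_i\le t}\xi_i .$$ Define $I:\mathbb{R}_+\to[0,\infty]$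 by $$I(u)=\begin{cases}\displaystyle\sup_{\lambda\in(-\infty,\Lambda)}\Bigl[\lambda u-r\int_0^\infty(e^{\lambda z}-1)\,dG(z)\Bigr],&u>0,\\[2mm] r\,[1-G(0+)],&u=0.\end{cases}$$ Then, as $t\to\infty$, the family $(S_t)$ satisfies the large deviation principle in $\mathbb{R}_+$ with the Euclidean metric, with speed $1/t$ and rate function $I$: $I$ is nonnegative and lower semicontinuous, $$\limsup_{t\to\infty}\frac1t\log\mathsf P(S_t\in F)\le-\inf_{u\in F}I(u)\quad\text{for every closed }F\subseteq\mathbb{R}_+,$$ $$\liminf_{t\to\infty}\frac1t\log\mathsf P(S_t\in O)\ge-\inf_{u\in O}I(u)\quad\text{for every open }O\subseteq\mathbb{R}_+ .$$ If moreover $\Lambda>0$, then $I$ is a good rate function: the sets $\{u:I(u)\le c\}$, $c\in\mathbb{R}$, are compact. -/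

import Mathlib

open MeasureTheory ProbabilityTheory Filter Set Topology
open scoped NNReal ENNReal

namespace MarkedPoisson

/-- The large deviation principle for a family `S` of `X`-valued random elements along the filter
`l`, with speed `ε` and rate function `I`. Values are in `[-∞, ∞]`; `log 0 = -∞` and the infimum
over the empty set is `∞`. -/
structure SatisfiesLDP {Ω ι X : Type*} [MeasurableSpace Ω] [TopologicalSpace X]
    (P : Measure Ω) (l : Filter ι) (ε : ι → ℝ) (S : ι → Ω → X) (I : X → EReal) : Prop where
  /-- the rate function is nonnegative -/
  nonneg : ∀ x, 0 ≤ I x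
  /-- the rate function is lower semicontinuous -/
  lsc : LowerSemicontinuous I
  /-- the upper bound for closed sets -/
  upper : ∀ F : Set X, IsClosed F →
    limsup (fun t => (ε t : EReal) * ENNReal.log (P {ω | S t ω ∈ F})) l ≤ -(⨅ x ∈ F, I x)
  /-- the lower bound for open sets -/
  lower : ∀ O : Set X, IsOpen O →
    -(⨅ x ∈ O, I x) ≤ liminf (fun t => (ε t : EReal) * ENNReal.log (P {ω | S t ω ∈ O})) l

/-- The rate function is good: its sublevel sets at real levels are compact. -/
def IsGoodRate {X : Type*} [TopologicalSpace X] (I : X → EReal) : Prop :=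
  ∀ c : ℝ, IsCompact {x | I x ≤ (c : EReal)}

/-- The history `σ((τ₁, ξ₁), …, (τₙ, ξₙ))`; it is trivial for `n = 0`. -/
def history {Ω : Type*} (τ : ℕ → Ω → ℝ) (ξ : ℕ → Ω → ℝ≥0) (n : ℕ) : MeasurableSpace Ω :=
  ⨆ i ∈ Finset.Icc 1 n, MeasurableSpace.comap (fun ω => (τ i ω, ξ i ω)) inferInstance

/-- The distribution function `x ↦ G([0, x])` of a law `G` on `[0, ∞)`. -/
noncomputable def distFun (G : Measure ℝ≥0) (x : ℝ≥0) : ℝ := G.real (Set.Iic x)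

/-- Arrival times `0 = τ₀ < τ₁ < τ₂ < …` with marks `ξ₁, ξ₂, … ≥ 0` of law `G` (the value `ξ 0` is
never used), such that, given the first `n` arrivals and marks, the next mark has law `G`, the
next waiting time is exponential with rate `r`, and the two are independent. -/
structure IsMarkedArrivals {Ω : Type*} [MeasurableSpace Ω] (P : Measure Ω) (r : ℝ)
    (G : Measure ℝ≥0) (τ : ℕ → Ω → ℝ) (ξ : ℕ → Ω → ℝ≥0) : Prop where
  measurable_arrival : ∀ i, Measurable (τ i)
  measurable_mark : ∀ i, 1 ≤ i → Measurable (ξ i)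
  arrival_zero : ∀ᵐ ω ∂P, τ 0 ω = 0
  arrival_strictMono : ∀ᵐ ω ∂P, StrictMono (fun i => τ i ω)
  law_mark : ∀ i, 1 ≤ i → P.map (ξ i) = G
  indep_mark : ∀ n,
    Indep (MeasurableSpace.comap (ξ (n + 1)) inferInstance) (history τ ξ n) P
  cond_arrival : ∀ (n : ℕ) (t : ℝ), ∀ᵐ ω ∂P, τ n ω ≤ t →
    (P⟦{ω' | τ (n + 1) ω' ≤ t} | history τ ξ n⟧) ω = 1 - Real.exp (-r * (t - τ n ω))
  cond_joint : ∀ (n : ℕ) (x : ℝ≥0) (t : ℝ), ∀ᵐ ω ∂P, τ n ω ≤ t →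
    (P⟦{ω' | ξ (n + 1) ω' ≤ x ∧ τ (n + 1) ω' ≤ t} | history τ ξ n⟧) ω
      = distFun G x * (1 - Real.exp (-r * (t - τ n ω)))

/-- `S_t = (1/t) ∑_{i ≥ 1, τ_i ≤ t} ξ_i`. Almost surely only finitely many terms are nonzero. -/
noncomputable def avg {Ω : Type*} (τ : ℕ → Ω → ℝ) (ξ : ℕ → Ω → ℝ≥0) (t : ℝ≥0) (ω : Ω) : ℝ≥0 :=
  t⁻¹ * ∑' i : ℕ, if 1 ≤ i ∧ τ i ω ≤ t then ξ i ω else 0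

/-- `Λ = inf {s > 0 : ∫ e^{sz} dG(z) = ∞}`, with value `∞` if there is no such `s`. -/
noncomputable def expBound (G : Measure ℝ≥0) : EReal :=
  ⨅ (s : ℝ) (_ : 0 < s ∧ ∫⁻ z : ℝ≥0, ENNReal.ofReal (Real.exp (s * z)) ∂G = ∞), (s : EReal)

open Classical in
/-- The rate function: `r (1 - G(0+))` at `u = 0`, where `G(0+)` is the right limit at `0` of the
distribution function, and `sup_{s < Λ} [s u - r ∫ (e^{sz} - 1) dG(z)]` for `u > 0`. -/
noncomputable def rate (r : ℝ) (G : Measure ℝ≥0) (u : ℝ≥0) : EReal :=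
  if u = 0 then ((r * (1 - Function.rightLim (distFun G) 0) : ℝ) : EReal)
  else ⨆ (s : ℝ) (_ : (s : EReal) < expBound G),
    ((s * u - r * ∫ z : ℝ≥0, (Real.exp (s * z) - 1) ∂G : ℝ) : EReal)

end MarkedPoisson

/-!
The marks accumulated up to time `t` form a compound Poisson process, and the theorem is Cramér's
theorem for it, without any moment assumption on the law `G` of the marks.

*Exponential moments.* Everything rests on one identity. If `B` is a set of marks on which `e^{sz}`
is integrable, then the integral of `exp (s ∑_{τ i ≤ t} ξ i)` over the event that all marks up to
time `t` lie in `B` is `exp (t K_B(s))`, where `K_B(s) = r (∫_B e^{sz} dG(z) - 1)`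
(`IsMarkedArrivals.lintegral_exp_total`). The hypotheses say that a mark is independent of the past
together with its own arrival time, and they give the conditional law of the next arrival. Hence the
integral of a product of weights `w (ξ i)` over the event of exactly `n` arrivals is
`(∫ w dG) ^ n e^{-rt} (rt)^n / n!`, by induction on `n`: under such a weight, the next arrival time
has a density proportional to the previous term. The case `w = 1` shows that arrivals do not
accumulate.

*Rate function.* The functions `u ↦ su - K(s)`, over all `s` with a finite exponential moment,
minorize the rate function and exhaust it (`sub_cumulant_le_rate`, `exists_lt_sub_cumulant`). At
`u = 0` this holds because `K(s)` decreases to `-r (1 - G{0})` as `s → -∞`. Nonnegativity, lower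
semicontinuity and compactness of the sublevel sets follow.

*Upper bound.* If the rate function exceeds `c` at `u`, Chernoff's inequality bounds the probability
of one of the half-lines with endpoint `u` by `e^{-tc}`. Such half-lines cover the closed set, and
nested half-lines cost nothing, so its probability is at most `2 e^{-tc}`.

*Lower bound.* For `u > 0` the marks are restricted to `[0, M]`, where the cumulant is
differentiable; if `su - K_M(s)` is maximal at `s`, the law tilted by `e^{sY}` concentrates at `u`,
again by Chernoff's inequality (`IsMarkedArrivals.eventually_exp_le`). A compactness argument shows
that the maxima decrease to at most the rate function as `M → ∞` (`exists_truncation`). For `u = 0`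
the event that all marks vanish suffices.
-/

namespace MarkedPoisson

/-! ### Conditional laws of the next arrival and the next mark -/

section Arrivals

variable {Ω : Type*} {τ : ℕ → Ω → ℝ} {ξ : ℕ → Ω → ℝ≥0}

theorem measurable_pair_history {i n : ℕ} (hi : 1 ≤ i) (hn : i ≤ n) :
    Measurable[history τ ξ n] fun ω => (τ i ω, ξ i ω) :=
  measurable_iff_comap_le.2 <|
    le_iSup₂ (f := fun i (_ : i ∈ Finset.Icc 1 n) =>
      MeasurableSpace.comap (fun ω => (τ i ω, ξ i ω)) inferInstance) i (Finset.mem_Icc.2 ⟨hi, hn⟩)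

theorem measurable_mark_history {i n : ℕ} (hi : 1 ≤ i) (hn : i ≤ n) :
    Measurable[history τ ξ n] (ξ i) :=
  measurable_snd.comp (measurable_pair_history (τ := τ) hi hn)

theorem measurable_arrival_history (h0 : τ 0 = 0) {i n : ℕ} (hn : i ≤ n) :
    Measurable[history τ ξ n] (τ i) := by
  rcases Nat.eq_zero_or_pos i with rfl | hi
  · rw [h0]; exact @measurable_const _ _ _ (history τ ξ n) 0
  · exact measurable_fst.comp (measurable_pair_history (ξ := ξ) hi hn)

theorem avg_update_zero : avg (Function.update τ 0 0) ξ = avg τ ξ := by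
  funext t ω
  unfold avg
  congr 2
  funext i
  rcases eq_or_ne i 0 with rfl | hi
  · simp
  · simp [hi]
variable [mΩ : MeasurableSpace Ω] {P : Measure Ω} {r : ℝ} {G : Measure ℝ≥0}

theorem IsMarkedArrivals.history_le (h : IsMarkedArrivals P r G τ ξ) (n : ℕ) :
    history τ ξ n ≤ mΩ :=
  iSup₂_le fun i hi => ((h.measurable_arrival i).prodMk
    (h.measurable_mark i (Finset.mem_Icc.1 hi).1)).comap_le

theorem IsMarkedArrivals.isProbabilityMeasure [IsProbabilityMeasure P]
    (h : IsMarkedArrivals P r G τ ξ) : IsProbabilityMeasure G := by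
  rw [← h.law_mark 1 le_rfl]
  exact Measure.isProbabilityMeasure_map (h.measurable_mark 1 le_rfl).aemeasurable

/-- The initial time may be made exactly, and not only almost surely, zero. -/
theorem IsMarkedArrivals.update_zero (h : IsMarkedArrivals P r G τ ξ) :
    IsMarkedArrivals P r G (Function.update τ 0 0) ξ := by
  have hae : ∀ᵐ ω ∂P, ∀ i, Function.update τ 0 0 i ω = τ i ω := by
    filter_upwards [h.arrival_zero] with ω hω i
    rcases eq_or_ne i 0 with rfl | hi
    · simp [hω]
    · simp [hi]
  have hhist : ∀ n, history (Function.update τ 0 0) ξ n = history τ ξ n := by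
    intro n
    unfold history
    refine iSup_congr fun i => iSup_congr fun hi => ?_
    have : i ≠ 0 := by have := (Finset.mem_Icc.1 hi).1; omega
    simp [this]
  refine ⟨fun i => ?_, h.measurable_mark, by simp, ?_, h.law_mark, fun n => ?_, fun n t => ?_,
    fun n x t => ?_⟩
  · rcases eq_or_ne i 0 with rfl | hi
    · rw [Function.update_self]; exact measurable_const
    · simpa [hi] using h.measurable_arrival i
  · filter_upwards [hae, h.arrival_strictMono] with ω hω hm
    simpa only [hω] using hm
  · rw [hhist]; exact h.indep_mark n
  · rw [hhist]
    filter_upwards [hae, h.cond_arrival n t] with ω hω hc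
    simpa [hω] using hc
  · rw [hhist]
    filter_upwards [hae, h.cond_joint n x t] with ω hω hc
    simpa [hω] using hc

/-- A conditional probability known only on `{τ n ≤ t}`, integrated over an event of the past.
Outside `{τ n ≤ t}` the event is null, and `ENNReal.ofReal` truncates the negative value of
`1 - exp (-r (t - τ n))` to `0`. -/
theorem IsMarkedArrivals.measure_inter_eq_of_condExp [IsProbabilityMeasure P]
    (h : IsMarkedArrivals P r G τ ξ) (h0 : τ 0 = 0) (hr : 0 < r) {n : ℕ} {t c : ℝ} (hc : 0 ≤ c)
    {B : Set Ω} (hB : MeasurableSet B) (hBt : ∀ ω ∈ B, τ (n + 1) ω ≤ t)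
    (hcond : ∀ᵐ ω ∂P, τ n ω ≤ t →
      (P⟦B | history τ ξ n⟧) ω = c * (1 - Real.exp (-r * (t - τ n ω))))
    {A : Set Ω} (hA : MeasurableSet[history τ ξ n] A) :
    P (A ∩ B) = ENNReal.ofReal c *
      ∫⁻ ω in A, ENNReal.ofReal (1 - Real.exp (-r * (t - τ n ω))) ∂P := by
  have hle := h.history_le n
  have hτ := measurable_arrival_history (ξ := ξ) h0 (le_refl n)
  have hTm : MeasurableSet[history τ ξ n] {ω | τ n ω ≤ t} :=
    hτ measurableSet_Iic
  set T := {ω | τ n ω ≤ t} with hT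
  have hAT : MeasurableSet[history τ ξ n] (A ∩ T) := MeasurableSet.inter hA hTm
  have e1 : P (A ∩ B) = P (A ∩ T ∩ B) := by
    refine measure_congr ?_
    filter_upwards [h.arrival_strictMono] with ω hm
    refine propext ⟨fun ⟨ha, hb⟩ => ⟨⟨ha, ?_⟩, hb⟩, fun ⟨⟨ha, _⟩, hb⟩ => ⟨ha, hb⟩⟩
    exact (hm (Nat.lt_succ_self n)).le.trans (hBt ω hb)
  have hint : Integrable (B.indicator fun _ => (1 : ℝ)) P :=
    (integrable_const 1).indicator hB
  have e2 := setIntegral_condExp hle hint hAT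
  have hcongr : (P⟦B | history τ ξ n⟧) =ᵐ[P.restrict (A ∩ T)]
      fun ω => c * (1 - Real.exp (-r * (t - τ n ω))) := by
    rw [Filter.EventuallyEq, ae_restrict_iff' (hle _ hAT)]
    filter_upwards [hcond] with ω hω hmem using hω hmem.2
  have hi2 : IntegrableOn (fun ω => c * (1 - Real.exp (-r * (t - τ n ω)))) (A ∩ T) P :=
    (integrable_condExp.integrableOn.congr hcongr)
  have hpos : 0 ≤ᵐ[P.restrict (A ∩ T)] fun ω => c * (1 - Real.exp (-r * (t - τ n ω))) := by
    rw [Filter.EventuallyLE, ae_restrict_iff' (hle _ hAT)]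
    refine ae_of_all _ fun ω hω => mul_nonneg hc ?_
    have : -r * (t - τ n ω) ≤ 0 := by
      have : τ n ω ≤ t := hω.2
      nlinarith
    simpa using this
  rw [integral_congr_ae hcongr, integral_indicator hB, Measure.restrict_restrict hB] at e2
  have e3 : P (A ∩ T ∩ B) =
      ENNReal.ofReal (∫ ω in A ∩ T, c * (1 - Real.exp (-r * (t - τ n ω))) ∂P) := by
    rw [e2]
    simp [inter_comm, measureReal_def]
  rw [e1, e3, ofReal_integral_eq_lintegral_ofReal hi2 hpos]
  simp_rw [ENNReal.ofReal_mul hc]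
  rw [lintegral_const_mul]
  · congr 1
    rw [← lintegral_indicator (hle _ hA), ← lintegral_indicator (hle _ hAT)]
    refine lintegral_congr fun ω => ?_
    by_cases ha : ω ∈ A
    swap
    · rw [indicator_of_notMem ha, indicator_of_notMem fun hb => ha hb.1]
    by_cases hb : ω ∈ T
    · rw [indicator_of_mem ha, indicator_of_mem (show ω ∈ A ∩ T from ⟨ha, hb⟩)]
    rw [indicator_of_mem ha, indicator_of_notMem fun hb' => hb hb'.2, eq_comm,
      ENNReal.ofReal_eq_zero]
    have hlt : t < τ n ω := not_le.1 hb
    have : 0 ≤ -r * (t - τ n ω) := by nlinarith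
    simpa using this
  · have := h.measurable_arrival n
    fun_prop

theorem IsMarkedArrivals.measure_inter_arrival_le [IsProbabilityMeasure P]
    (h : IsMarkedArrivals P r G τ ξ) (h0 : τ 0 = 0) (hr : 0 < r) (n : ℕ) (t : ℝ)
    {A : Set Ω} (hA : MeasurableSet[history τ ξ n] A) :
    P (A ∩ {ω | τ (n + 1) ω ≤ t}) =
      ∫⁻ ω in A, ENNReal.ofReal (1 - Real.exp (-r * (t - τ n ω))) ∂P := by
  have := h.measure_inter_eq_of_condExp h0 hr (c := 1) zero_le_one (B := {ω | τ (n + 1) ω ≤ t})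
    (measurableSet_le (h.measurable_arrival _) measurable_const) (fun ω hω => hω)
    (by simpa only [one_mul] using h.cond_arrival n t) hA
  simpa using this

theorem IsMarkedArrivals.measure_inter_mark_arrival_le [IsProbabilityMeasure P]
    (h : IsMarkedArrivals P r G τ ξ) (h0 : τ 0 = 0) (hr : 0 < r) (n : ℕ) (x : ℝ≥0) (t : ℝ)
    {A : Set Ω} (hA : MeasurableSet[history τ ξ n] A) :
    P (A ∩ {ω | ξ (n + 1) ω ≤ x ∧ τ (n + 1) ω ≤ t}) =
      G (Iic x) * P (A ∩ {ω | τ (n + 1) ω ≤ t}) := by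
  have hG := h.isProbabilityMeasure
  rw [h.measure_inter_arrival_le h0 hr n t hA,
    h.measure_inter_eq_of_condExp h0 hr (c := distFun G x) measureReal_nonneg
    (B := {ω | ξ (n + 1) ω ≤ x ∧ τ (n + 1) ω ≤ t}) ?_ (fun ω hω => hω.2) (h.cond_joint n x t) hA]
  · simp [distFun]
  · exact (measurableSet_le (h.measurable_mark _ (by omega)) measurable_const).inter
      (measurableSet_le (h.measurable_arrival _) measurable_const)

/-- The mark of an arrival is independent of the past together with the time of that arrival. -/
theorem IsMarkedArrivals.indep_mark_sup_arrival [IsProbabilityMeasure P]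
    (h : IsMarkedArrivals P r G τ ξ) (h0 : τ 0 = 0) (hr : 0 < r) (n : ℕ) :
    Indep (MeasurableSpace.comap (ξ (n + 1)) inferInstance)
      (history τ ξ n ⊔ MeasurableSpace.comap (τ (n + 1)) inferInstance) P := by
  have hξm := h.measurable_mark (n + 1) (by omega)
  have hτm := h.measurable_arrival (n + 1)
  have hle := h.history_le n
  set p1 : Set (Set Ω) := preimage (ξ (n + 1)) '' range Iic with hp1
  set p2 : Set (Set Ω) := {s | ∃ A, MeasurableSet[history τ ξ n] A ∧ ∃ t : ℝ,
    A ∩ {ω | τ (n + 1) ω ≤ t} = s} with hp2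
  have hm2 : history τ ξ n ⊔ MeasurableSpace.comap (τ (n + 1)) inferInstance =
      MeasurableSpace.generateFrom p2 := by
    apply le_antisymm
    · refine sup_le (fun A hA => ?_) ?_
      · have : A = ⋃ k : ℕ, A ∩ {ω | τ (n + 1) ω ≤ k} := by
          rw [← inter_iUnion, eq_comm, inter_eq_left]
          intro ω _
          obtain ⟨k, hk⟩ := exists_nat_ge (τ (n + 1) ω)
          exact mem_iUnion.2 ⟨k, hk⟩
        rw [this]
        exact MeasurableSet.iUnion fun k =>
          MeasurableSpace.measurableSet_generateFrom ⟨A, hA, k, rfl⟩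
      · rw [(by infer_instance : BorelSpace ℝ).measurable_eq, borel_eq_generateFrom_Iic,
          MeasurableSpace.comap_generateFrom]
        refine MeasurableSpace.generateFrom_mono ?_
        rintro _ ⟨_, ⟨t, rfl⟩, rfl⟩
        exact ⟨univ, MeasurableSet.univ, t, by ext; simp⟩
    · refine MeasurableSpace.generateFrom_le ?_
      rintro _ ⟨A, hA, t, rfl⟩
      refine MeasurableSet.inter
        ((le_sup_left : history τ ξ n ≤ history τ ξ n ⊔ _) A hA) ?_
      exact (le_sup_right : MeasurableSpace.comap (τ (n + 1)) inferInstance ≤ history τ ξ n ⊔ _) _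
        ⟨Iic t, measurableSet_Iic, rfl⟩
  refine IndepSets.indep (p1 := p1) (p2 := p2) hξm.comap_le (sup_le hle hτm.comap_le) ?_ ?_ ?_
    hm2 ?_
  · rintro _ ⟨_, ⟨x, rfl⟩, rfl⟩ _ ⟨_, ⟨y, rfl⟩, rfl⟩ _
    exact ⟨Iic (x ⊓ y), ⟨_, rfl⟩, by rw [← Iic_inter_Iic, preimage_inter]⟩
  · rintro _ ⟨A, hA, t, rfl⟩ _ ⟨A', hA', t', rfl⟩ _
    refine ⟨A ∩ A', MeasurableSet.inter hA hA', t ⊓ t', ?_⟩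
    ext ω
    simp only [mem_inter_iff, mem_ofPred_eq, le_inf_iff]
    tauto
  · rw [(by infer_instance : BorelSpace ℝ≥0).measurable_eq, borel_eq_generateFrom_Iic,
      MeasurableSpace.comap_generateFrom]
  · rw [IndepSets_iff]
    rintro _ _ ⟨_, ⟨x, rfl⟩, rfl⟩ ⟨A, hA, t, rfl⟩
    have e : ξ (n + 1) ⁻¹' Iic x ∩ (A ∩ {ω | τ (n + 1) ω ≤ t}) =
        A ∩ {ω | ξ (n + 1) ω ≤ x ∧ τ (n + 1) ω ≤ t} := by
      ext ω
      simp only [mem_inter_iff, mem_preimage, mem_Iic, mem_ofPred_eq]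
      tauto
    rw [e, h.measure_inter_mark_arrival_le h0 hr n x t hA, ← h.law_mark (n + 1) (by omega),
      Measure.map_apply hξm measurableSet_Iic]

/-- Integrating out the mark of an arrival. -/
theorem IsMarkedArrivals.lintegral_mul_mark [IsProbabilityMeasure P]
    (h : IsMarkedArrivals P r G τ ξ) (h0 : τ 0 = 0) (hr : 0 < r) (n : ℕ)
    {W : Ω → ℝ≥0∞} (hW : Measurable[history τ ξ n] W)
    {w : ℝ≥0 → ℝ≥0∞} (hw : Measurable w) {f : ℝ → ℝ≥0∞} (hf : Measurable f) :
    ∫⁻ ω, W ω * w (ξ (n + 1) ω) * f (τ (n + 1) ω) ∂P =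
      (∫⁻ z, w z ∂G) * ∫⁻ ω, W ω * f (τ (n + 1) ω) ∂P := by
  have hξm := h.measurable_mark (n + 1) (by omega)
  have hτm := h.measurable_arrival (n + 1)
  have hmw : Measurable[history τ ξ n ⊔ MeasurableSpace.comap (τ (n + 1)) inferInstance]
      fun ω => W ω * f (τ (n + 1) ω) := by
    refine Measurable.mul (hW.mono le_sup_left le_rfl) ?_
    exact (hf.comp (comap_measurable (τ (n + 1)))).mono le_sup_right le_rfl
  have := lintegral_mul_eq_lintegral_mul_lintegral_of_independent_measurableSpace
    hξm.comap_le (sup_le (h.history_le n) hτm.comap_le) (h.indep_mark_sup_arrival h0 hr n)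
    (f := fun ω => w (ξ (n + 1) ω)) (hw.comp (comap_measurable (ξ (n + 1)))) hmw
  rw [← h.law_mark (n + 1) (by omega), lintegral_map hw hξm, ← this]
  refine lintegral_congr fun ω => ?_
  ring

/-- The conditional law of the next arrival time, integrated against a weight from the past. -/
theorem IsMarkedArrivals.lintegral_mul_arrival_le [IsProbabilityMeasure P]
    (h : IsMarkedArrivals P r G τ ξ) (h0 : τ 0 = 0) (hr : 0 < r) (n : ℕ) (t : ℝ)
    {W : Ω → ℝ≥0∞} (hW : Measurable[history τ ξ n] W) :
    ∫⁻ ω in {ω | τ (n + 1) ω ≤ t}, W ω ∂P =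
      ∫⁻ ω, ENNReal.ofReal (1 - Real.exp (-r * (t - τ n ω))) * W ω ∂P := by
  have hle := h.history_le n
  have hgm : Measurable fun ω => ENNReal.ofReal (1 - Real.exp (-r * (t - τ n ω))) := by
    have := h.measurable_arrival n
    fun_prop
  have key : (P.restrict {ω | τ (n + 1) ω ≤ t}).trim hle =
      (P.withDensity fun ω => ENNReal.ofReal (1 - Real.exp (-r * (t - τ n ω)))).trim hle := by
    refine @Measure.ext _ (history τ ξ n) _ _ fun A hA => ?_
    rw [trim_measurableSet_eq hle hA, trim_measurableSet_eq hle hA,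
      Measure.restrict_apply (hle _ hA), withDensity_apply _ (hle _ hA),
      h.measure_inter_arrival_le h0 hr n t hA]
  rw [← lintegral_trim hle hW, key, lintegral_trim hle hW,
    lintegral_withDensity_eq_lintegral_mul _ hgm (hW.mono hle le_rfl)]
  rfl

end Arrivals

/-! ### The number of arrivals is Poisson, also under weights on the marks -/

section Poisson

theorem lintegral_Icc_of_hasDerivAt {f F : ℝ → ℝ} (hF : ∀ x, HasDerivAt F (f x) x)
    (hf : Continuous f) {a t : ℝ} (hat : a ≤ t) (hpos : ∀ x ∈ Icc a t, 0 ≤ f x) :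
    ∫⁻ x in Icc a t, ENNReal.ofReal (f x) = ENNReal.ofReal (F t - F a) := by
  rw [← ofReal_integral_eq_lintegral_ofReal]
  · rw [integral_Icc_eq_integral_Ioc, ← intervalIntegral.integral_of_le hat,
      intervalIntegral.integral_eq_sub_of_hasDerivAt (fun x _ => hF x)
        (hf.intervalIntegrable _ _)]
  · exact hf.continuousOn.integrableOn_Icc
  · rw [Filter.EventuallyLE, ae_restrict_iff' measurableSet_Icc]
    exact ae_of_all _ hpos

/-- The probability that no arrival falls in `(a, x]`, given an arrival at `a`, as a function of
`a` and `x`; it is set to `0` for `x < a`. -/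
noncomputable def gapProb (r a x : ℝ) : ℝ≥0∞ :=
  if a ≤ x then ENNReal.ofReal (Real.exp (-r * (x - a))) else 0

/-- The Poisson probability `e^{-rt} (rt)^n / n!`, set to `0` for `t < 0`. -/
noncomputable def poissonWeight (r : ℝ) (n : ℕ) (t : ℝ) : ℝ≥0∞ :=
  if 0 ≤ t then ENNReal.ofReal (Real.exp (-r * t) * ((r * t) ^ n / n.factorial)) else 0

theorem measurable_gapProb (r : ℝ) : Measurable fun p : ℝ × ℝ => gapProb r p.1 p.2 := by
  unfold gapProb
  exact Measurable.ite (measurableSet_le measurable_fst measurable_snd) (by fun_prop)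
    measurable_const

theorem measurable_poissonWeight (r : ℝ) (n : ℕ) : Measurable (poissonWeight r n) := by
  unfold poissonWeight
  exact Measurable.ite measurableSet_Ici (by fun_prop) measurable_const

theorem lintegral_gapProb {r : ℝ} (hr : 0 < r) (a t : ℝ) :
    ∫⁻ x in Iic t, ENNReal.ofReal r * gapProb r a x =
      ENNReal.ofReal (1 - Real.exp (-r * (t - a))) := by
  have e : ∫⁻ x in Iic t, ENNReal.ofReal r * gapProb r a x =
      ∫⁻ x in Icc a t, ENNReal.ofReal (r * Real.exp (-r * (x - a))) := by
    rw [← lintegral_indicator measurableSet_Iic, ← lintegral_indicator measurableSet_Icc]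
    refine lintegral_congr fun x => ?_
    by_cases h1 : x ≤ t <;> by_cases h2 : a ≤ x <;>
      simp [gapProb, indicator, h1, h2, ENNReal.ofReal_mul hr.le]
  rw [e]
  rcases le_or_gt a t with h | h
  · rw [lintegral_Icc_of_hasDerivAt (F := fun x => -Real.exp (-r * (x - a))) _ (by fun_prop) h]
    · congr 1; simp; ring
    · intro x _; positivity
    · intro x
      have := ((((hasDerivAt_id x).sub_const a).const_mul (-r)).exp).neg
      convert! this using 1
      simp; ring
  · rw [Icc_eq_empty (not_le.2 h), Measure.restrict_empty, lintegral_zero_measure, eq_comm,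
      ENNReal.ofReal_eq_zero]
    have : 0 ≤ -r * (t - a) := by nlinarith
    simpa using this

theorem lintegral_gapProb_mul_poissonWeight {r : ℝ} (hr : 0 < r) (n : ℕ) (t : ℝ) :
    ∫⁻ x, ENNReal.ofReal r * poissonWeight r n x * gapProb r x t = poissonWeight r (n + 1) t := by
  have e : ∫⁻ x, ENNReal.ofReal r * poissonWeight r n x * gapProb r x t =
      ∫⁻ x in Icc 0 t, ENNReal.ofReal (Real.exp (-r * t) * (r * ((r * x) ^ n / n.factorial))) := by
    rw [← lintegral_indicator measurableSet_Icc]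
    refine lintegral_congr fun x => ?_
    by_cases h1 : 0 ≤ x <;> by_cases h2 : x ≤ t <;> simp [gapProb, poissonWeight, h1, h2]
    rw [← ENNReal.ofReal_mul hr.le, ← ENNReal.ofReal_mul (by positivity)]
    congr 1
    have : Real.exp (-(r * t)) = Real.exp (-(r * x)) * Real.exp (-(r * (t - x))) := by
      rw [← Real.exp_add]; ring_nf
    rw [this]; ring
  rw [e]
  rcases le_or_gt 0 t with h | h
  · rw [lintegral_Icc_of_hasDerivAt
      (F := fun x => Real.exp (-r * t) * ((r * x) ^ (n + 1) / (n + 1).factorial)) _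
      (by fun_prop) h]
    · simp [poissonWeight, h]
    · intro x hx
      have := hx.1
      positivity
    · intro x
      have := (((((hasDerivAt_id x).const_mul r).pow (n + 1)).div_const
        ((n + 1).factorial : ℝ)).const_mul (Real.exp (-r * t)))
      convert! this using 1
      have h1 : (n.factorial : ℝ) ≠ 0 := by positivity
      have h2 : (n : ℝ) + 1 ≠ 0 := by positivity
      simp [Nat.factorial_succ]
      field_simp
  · rw [Icc_eq_empty (not_le.2 h), Measure.restrict_empty, lintegral_zero_measure]
    simp [poissonWeight, not_le.2 h]

variable {Ω : Type*} {ξ : ℕ → Ω → ℝ≥0} {τ : ℕ → Ω → ℝ}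

/-- The product of the weights of the first `n` marks. -/
noncomputable def markWeight (ξ : ℕ → Ω → ℝ≥0) (w : ℝ≥0 → ℝ≥0∞) (n : ℕ) (ω : Ω) : ℝ≥0∞ :=
  ∏ i ∈ Finset.Icc 1 n, w (ξ i ω)

theorem markWeight_succ (w : ℝ≥0 → ℝ≥0∞) (n : ℕ) (ω : Ω) :
    markWeight ξ w (n + 1) ω = markWeight ξ w n ω * w (ξ (n + 1) ω) :=
  Finset.prod_Icc_succ_top (by omega) _

theorem measurable_markWeight {w : ℝ≥0 → ℝ≥0∞} (hw : Measurable w) (n : ℕ) :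
    Measurable[history τ ξ n] (markWeight ξ w n) :=
  Finset.measurable_fun_prod _ fun _ hi => hw.comp
    (measurable_mark_history (Finset.mem_Icc.1 hi).1 (Finset.mem_Icc.1 hi).2)

variable [mΩ : MeasurableSpace Ω] {P : Measure Ω} {r : ℝ} {G : Measure ℝ≥0}

/-- The event that exactly `n` arrivals have occurred by time `t`. -/
def countEvent (τ : ℕ → Ω → ℝ) (t : ℝ) (n : ℕ) : Set Ω := {ω | τ n ω ≤ t ∧ t < τ (n + 1) ω}

theorem IsMarkedArrivals.measurableSet_countEvent (h : IsMarkedArrivals P r G τ ξ) (t : ℝ)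
    (n : ℕ) : MeasurableSet (countEvent τ t n) :=
  (measurableSet_le (h.measurable_arrival _) measurable_const).inter
    (measurableSet_lt measurable_const (h.measurable_arrival _))

theorem IsMarkedArrivals.ae_pairwise_disjoint (h : IsMarkedArrivals P r G τ ξ) (t : ℝ) :
    Pairwise (Function.onFun (AEDisjoint P) (countEvent τ t)) := by
  have key : ∀ m n, m < n → AEDisjoint P (countEvent τ t m) (countEvent τ t n) := by
    intro m n hmn
    refine measure_mono_null ?_ (ae_iff.1 h.arrival_strictMono)
    rintro ω ⟨h1, h2⟩ hm
    exact absurd (hm.monotone (Nat.succ_le_of_lt hmn)) (not_le.2 (h2.1.trans_lt h1.2))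
  intro m n hmn
  rcases lt_or_gt_of_ne hmn with h' | h'
  · exact key m n h'
  · exact (key n m h').symm

variable [IsProbabilityMeasure P]

theorem IsMarkedArrivals.lintegral_markWeight (h : IsMarkedArrivals P r G τ ξ) (h0 : τ 0 = 0)
    (hr : 0 < r) {w : ℝ≥0 → ℝ≥0∞} (hw : Measurable w) (n : ℕ) :
    ∫⁻ ω, markWeight ξ w n ω ∂P = (∫⁻ z, w z ∂G) ^ n := by
  induction n with
  | zero => simp [markWeight]
  | succ n ih =>
    have := h.lintegral_mul_mark h0 hr n (measurable_markWeight hw n) hw (f := 1)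
      measurable_const
    simp only [Pi.one_apply, mul_one, ih] at this
    simp_rw [markWeight_succ, this, pow_succ']

/-- Under the weight of the first `n` marks, the next arrival time has density
`x ↦ r E[markWeight n; τ n ≤ x < τ (n + 1)]`. -/
theorem IsMarkedArrivals.map_arrival_withDensity (h : IsMarkedArrivals P r G τ ξ) (h0 : τ 0 = 0)
    (hr : 0 < r) {w : ℝ≥0 → ℝ≥0∞} (hw : Measurable w) (hfin : ∫⁻ z, w z ∂G ≠ ∞) (n : ℕ) :
    (P.withDensity (markWeight ξ w n)).map (τ (n + 1)) =
      volume.withDensity fun x =>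
        ENNReal.ofReal r * ∫⁻ ω, markWeight ξ w n ω * gapProb r (τ n ω) x ∂P := by
  have hWm : Measurable (markWeight ξ w n) :=
    (measurable_markWeight (τ := τ) hw n).mono (h.history_le n) le_rfl
  have hgm : Measurable fun p : ℝ × Ω => gapProb r (τ n p.2) p.1 :=
    (measurable_gapProb r).comp (((h.measurable_arrival n).comp measurable_snd).prodMk
      measurable_fst)
  have hgm' : Measurable fun p : Ω × ℝ => gapProb r (τ n p.1) p.2 :=
    (measurable_gapProb r).comp (((h.measurable_arrival n).comp measurable_fst).prodMk
      measurable_snd)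
  have : IsFiniteMeasure (P.withDensity (markWeight ξ w n)) :=
    isFiniteMeasure_withDensity (by
      rw [h.lintegral_markWeight h0 hr hw]; exact ENNReal.pow_ne_top hfin)
  refine Measure.ext_of_Iic _ _ fun t => ?_
  have hS : MeasurableSet {ω | τ (n + 1) ω ≤ t} :=
    measurableSet_le (h.measurable_arrival _) measurable_const
  rw [Measure.map_apply (h.measurable_arrival _) measurableSet_Iic,
    withDensity_apply _ measurableSet_Iic,
    show τ (n + 1) ⁻¹' Iic t = {ω | τ (n + 1) ω ≤ t} from rfl, withDensity_apply _ hS,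
    h.lintegral_mul_arrival_le h0 hr n t (measurable_markWeight hw n)]
  simp_rw [← lintegral_gapProb hr]
  rw [lintegral_const_mul' _ _ ENNReal.ofReal_ne_top, lintegral_lintegral_swap]
  · rw [← lintegral_const_mul' _ _ ENNReal.ofReal_ne_top]
    refine lintegral_congr fun ω => ?_
    rw [lintegral_const_mul' _ _ ENNReal.ofReal_ne_top, lintegral_const_mul, mul_comm, ← mul_assoc,
      ← mul_assoc, mul_comm (ENNReal.ofReal r)]
    exact hgm'.comp measurable_prodMk_left
  · exact ((hWm.comp measurable_snd).mul hgm).aemeasurable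

theorem IsMarkedArrivals.lintegral_markWeight_mul_gapProb (h : IsMarkedArrivals P r G τ ξ)
    (h0 : τ 0 = 0) (hr : 0 < r) {w : ℝ≥0 → ℝ≥0∞} (hw : Measurable w)
    (hfin : ∫⁻ z, w z ∂G ≠ ∞) (n : ℕ) (t : ℝ) :
    ∫⁻ ω, markWeight ξ w n ω * gapProb r (τ n ω) t ∂P =
      (∫⁻ z, w z ∂G) ^ n * poissonWeight r n t := by
  induction n generalizing t with
  | zero => simp [markWeight, h0, gapProb, poissonWeight]
  | succ n ih =>
    have hg : Measurable fun x => gapProb r x t :=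
      (measurable_gapProb r).comp measurable_prodMk_right
    have hWm : Measurable (markWeight ξ w n) :=
      (measurable_markWeight (τ := τ) hw n).mono (h.history_le n) le_rfl
    simp_rw [markWeight_succ]
    rw [h.lintegral_mul_mark h0 hr n (measurable_markWeight hw n) hw hg]
    have e : ∫⁻ ω, markWeight ξ w n ω * gapProb r (τ (n + 1) ω) t ∂P =
        ∫⁻ x, gapProb r x t ∂((P.withDensity (markWeight ξ w n)).map (τ (n + 1))) := by
      rw [lintegral_map hg (h.measurable_arrival _),
        lintegral_withDensity_eq_lintegral_mul _ hWm
          (show Measurable fun ω => gapProb r (τ (n + 1) ω) t from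
            hg.comp (h.measurable_arrival _))]
      rfl
    rw [e, h.map_arrival_withDensity h0 hr hw hfin]
    simp_rw [ih]
    rw [lintegral_withDensity_eq_lintegral_mul _
      (((measurable_poissonWeight r n).const_mul _).const_mul _) hg,
      ← lintegral_gapProb_mul_poissonWeight hr, pow_succ', mul_assoc,
      ← lintegral_const_mul' _ _ (ENNReal.pow_ne_top hfin)]
    congr 1
    refine lintegral_congr fun x => ?_
    simp only [Pi.mul_apply]
    ring

theorem IsMarkedArrivals.setLIntegral_markWeight_countEvent (h : IsMarkedArrivals P r G τ ξ)
    (h0 : τ 0 = 0) (hr : 0 < r) {w : ℝ≥0 → ℝ≥0∞} (hw : Measurable w)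
    (hfin : ∫⁻ z, w z ∂G ≠ ∞) (n : ℕ) (t : ℝ) :
    ∫⁻ ω in countEvent τ t n, markWeight ξ w n ω ∂P =
      (∫⁻ z, w z ∂G) ^ n * poissonWeight r n t := by
  rw [← h.lintegral_markWeight_mul_gapProb h0 hr hw hfin]
  have hτm := h.measurable_arrival n
  have hWh := measurable_markWeight (τ := τ) (ξ := ξ) hw n
  have hWm : Measurable (markWeight ξ w n) := hWh.mono (h.history_le n) le_rfl
  set T := {ω | τ n ω ≤ t} with hT
  set T' := {ω | τ (n + 1) ω ≤ t} with hT'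
  have hTh : MeasurableSet[history τ ξ n] T :=
    measurable_arrival_history (ξ := ξ) h0 (le_refl n) measurableSet_Iic
  have hTm : MeasurableSet T := h.history_le n _ hTh
  have hTm' : MeasurableSet T' := measurableSet_le (h.measurable_arrival _) measurable_const
  have h1 := h.lintegral_mul_arrival_le h0 hr n t (hWh.indicator hTh)
  -- both decompositions of `{τ n ≤ t}` contain the part `{τ (n + 1) ≤ t}`, which is cancelled
  have h2 : ∫⁻ ω in T, markWeight ξ w n ω ∂P =
      ∫⁻ ω in countEvent τ t n, markWeight ξ w n ω ∂P +
        ∫⁻ ω in T', T.indicator (markWeight ξ w n) ω ∂P := by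
    have e : countEvent τ t n = T \ T' := by
      ext ω; simp [countEvent, hT, hT']
    rw [← lintegral_inter_add_sdiff _ T hTm', e, add_comm, setLIntegral_indicator hTm]
  have h3 : ∫⁻ ω in T, markWeight ξ w n ω ∂P =
      ∫⁻ ω, markWeight ξ w n ω * gapProb r (τ n ω) t ∂P +
        ∫⁻ ω, ENNReal.ofReal (1 - Real.exp (-r * (t - τ n ω))) *
          T.indicator (markWeight ξ w n) ω ∂P := by
    rw [← lintegral_add_left, ← lintegral_indicator hTm]
    · refine lintegral_congr fun ω => ?_
      by_cases hω : τ n ω ≤ t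
      · have hmem : ω ∈ T := hω
        rw [indicator_of_mem hmem, gapProb, if_pos hω, mul_comm, ← add_mul,
          ← ENNReal.ofReal_add (Real.exp_nonneg _)]
        · simp
        · have : -r * (t - τ n ω) ≤ 0 := by nlinarith
          simpa using this
      · have hmem : ω ∉ T := hω
        rw [indicator_of_notMem hmem, gapProb, if_neg hω]; simp
    · exact hWm.mul ((measurable_gapProb r).comp (hτm.prodMk measurable_const))
  have hfin' : ∫⁻ ω in T', T.indicator (markWeight ξ w n) ω ∂P ≠ ∞ := by
    refine ne_top_of_le_ne_top (b := ∫⁻ ω, markWeight ξ w n ω ∂P) ?_ ?_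
    · rw [h.lintegral_markWeight h0 hr hw]; exact ENNReal.pow_ne_top hfin
    · exact (setLIntegral_le_lintegral _ _).trans
        (lintegral_mono fun ω => indicator_le_self _ _ ω)
  rw [h2, ← h1] at h3
  exact (ENNReal.add_left_inj hfin').1 h3

/-- Summing over the number of arrivals. -/
theorem IsMarkedArrivals.tsum_setLIntegral_markWeight (h : IsMarkedArrivals P r G τ ξ)
    (h0 : τ 0 = 0) (hr : 0 < r) {w : ℝ≥0 → ℝ≥0∞} (hw : Measurable w) {φ : ℝ} (hφ : 0 ≤ φ)
    (hint : ∫⁻ z, w z ∂G = ENNReal.ofReal φ) {t : ℝ} (ht : 0 ≤ t) :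
    ∑' n, ∫⁻ ω in countEvent τ t n, markWeight ξ w n ω ∂P =
      ENNReal.ofReal (Real.exp (t * (r * (φ - 1)))) := by
  have hfin : ∫⁻ z, w z ∂G ≠ ∞ := by rw [hint]; exact ENNReal.ofReal_ne_top
  simp_rw [h.setLIntegral_markWeight_countEvent h0 hr hw hfin, hint, poissonWeight, if_pos ht,
    ← ENNReal.ofReal_pow hφ, ← ENNReal.ofReal_mul (pow_nonneg hφ _)]
  have hs : HasSum (fun n : ℕ => φ ^ n * (Real.exp (-r * t) * ((r * t) ^ n / n.factorial)))
      (Real.exp (t * (r * (φ - 1)))) := by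
    have := (NormedSpace.expSeries_div_hasSum_exp (𝔸 := ℝ) (φ * (r * t))).mul_left
      (Real.exp (-r * t))
    rw [← Real.exp_eq_exp_ℝ, ← Real.exp_add] at this
    convert! this using 1
    · funext n
      rw [mul_pow]; ring
    · ring_nf
  rw [← ENNReal.ofReal_tsum_of_nonneg _ hs.summable, hs.tsum_eq]
  intro n
  positivity

/-- The arrivals do not accumulate: their number up to time `t` is finite. -/
theorem IsMarkedArrivals.ae_exists_countEvent (h : IsMarkedArrivals P r G τ ξ)
    (h0 : τ 0 = 0) (hr : 0 < r) {t : ℝ} (ht : 0 ≤ t) :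
    ∀ᵐ ω ∂P, ∃ n, ω ∈ countEvent τ t n := by
  have hG := h.isProbabilityMeasure
  have := h.tsum_setLIntegral_markWeight h0 hr (w := fun _ => 1) measurable_const
    (φ := 1) zero_le_one (by simp) ht
  simp only [markWeight, Finset.prod_const_one, lintegral_one, Measure.restrict_apply_univ,
    sub_self, mul_zero, Real.exp_zero, ENNReal.ofReal_one] at this
  rw [← measure_iUnion₀ (h.ae_pairwise_disjoint t)
    fun n => (h.measurableSet_countEvent t n).nullMeasurableSet] at this
  have hm := (prob_compl_eq_zero_iff
    (MeasurableSet.iUnion fun n => h.measurableSet_countEvent t n)).2 this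
  rw [ae_iff]
  convert hm using 2
  ext ω; simp

end Poisson

/-! ### Exponential moments of the accumulated marks -/

section Moments

/-- The cumulant `r (∫_B e^{sz} dG(z) - 1)` of the marks accumulated per unit of time, on the event
that all of them lie in `B`. It includes the exponential cost `-r (1 - G(B))` of that event. -/
noncomputable def cumulant (r : ℝ) (G : Measure ℝ≥0) (B : Set ℝ≥0) (s : ℝ) : ℝ :=
  r * (∫ z in B, Real.exp (s * z) ∂G - 1)

variable {Ω : Type*} {ξ : ℕ → Ω → ℝ≥0} {τ : ℕ → Ω → ℝ}

/-- The sum of the marks of the arrivals up to time `t`. -/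
noncomputable def total (τ : ℕ → Ω → ℝ) (ξ : ℕ → Ω → ℝ≥0) (t : ℝ) (ω : Ω) : ℝ≥0 :=
  ∑' i : ℕ, if 1 ≤ i ∧ τ i ω ≤ t then ξ i ω else 0

theorem avg_eq (t : ℝ≥0) (ω : Ω) : avg τ ξ t ω = t⁻¹ * total τ ξ t ω := rfl

/-- The event that all the marks of the arrivals up to time `t` lie in `B`. -/
def marksIn (τ : ℕ → Ω → ℝ) (ξ : ℕ → Ω → ℝ≥0) (B : Set ℝ≥0) (t : ℝ) : Set Ω :=
  {ω | ∀ i, 1 ≤ i → τ i ω ≤ t → ξ i ω ∈ B}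

theorem le_iff_of_mem_countEvent {t : ℝ} {n : ℕ} {ω : Ω} (hm : StrictMono fun i => τ i ω)
    (hω : ω ∈ countEvent τ t n) (i : ℕ) : τ i ω ≤ t ↔ i ≤ n := by
  refine ⟨fun hi => ?_, fun hi => (hm.monotone hi).trans hω.1⟩
  by_contra hcon
  exact absurd (hm.monotone (Nat.succ_le_of_lt (not_le.1 hcon))) (not_le.2 (hi.trans_lt hω.2))

theorem total_of_mem_countEvent {t : ℝ} {n : ℕ} {ω : Ω} (hm : StrictMono fun i => τ i ω)
    (hω : ω ∈ countEvent τ t n) : total τ ξ t ω = ∑ i ∈ Finset.Icc 1 n, ξ i ω := by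
  unfold total
  simp_rw [le_iff_of_mem_countEvent hm hω]
  rw [tsum_eq_sum (s := Finset.Icc 1 n)]
  · exact Finset.sum_congr rfl fun i hi => if_pos (Finset.mem_Icc.1 hi)
  · intro i hi
    exact if_neg fun h => hi (Finset.mem_Icc.2 h)

theorem markWeight_indicator_exp {t : ℝ} {n : ℕ} {ω : Ω} (hm : StrictMono fun i => τ i ω)
    (hω : ω ∈ countEvent τ t n) (B : Set ℝ≥0) (s : ℝ) :
    markWeight ξ (B.indicator fun z => ENNReal.ofReal (Real.exp (s * z))) n ω =
      (marksIn τ ξ B t).indicator (fun ω => ENNReal.ofReal (Real.exp (s * total τ ξ t ω))) ω := by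
  unfold markWeight
  by_cases h : ω ∈ marksIn τ ξ B t
  · rw [indicator_of_mem h, total_of_mem_countEvent hm hω]
    push_cast
    rw [Finset.mul_sum, Real.exp_sum, ENNReal.ofReal_prod_of_nonneg fun _ _ => Real.exp_nonneg _]
    refine Finset.prod_congr rfl fun i hi => ?_
    rw [Finset.mem_Icc] at hi
    rw [indicator_of_mem (h i hi.1 ((le_iff_of_mem_countEvent hm hω i).2 hi.2))]
  · rw [indicator_of_notMem h]
    simp only [marksIn, mem_ofPred_eq, not_forall] at h
    obtain ⟨i, h1, h2, h3⟩ := h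
    exact Finset.prod_eq_zero
      (Finset.mem_Icc.2 ⟨h1, (le_iff_of_mem_countEvent hm hω i).1 h2⟩) (indicator_of_notMem h3 _)

variable [mΩ : MeasurableSpace Ω] {P : Measure Ω} {r : ℝ} {G : Measure ℝ≥0}

theorem IsMarkedArrivals.measurableSet_marksIn (h : IsMarkedArrivals P r G τ ξ) {B : Set ℝ≥0}
    (hB : MeasurableSet B) (t : ℝ) : MeasurableSet (marksIn τ ξ B t) := by
  have e : marksIn τ ξ B t = ⋂ i, ⋂ (_ : 1 ≤ i), {ω | τ i ω ≤ t}ᶜ ∪ ξ i ⁻¹' B := by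
    ext ω
    simp only [marksIn, mem_ofPred_eq, mem_iInter, mem_union, mem_compl_iff, mem_preimage,
      imp_iff_not_or]
  rw [e]
  exact MeasurableSet.iInter fun i => MeasurableSet.iInter fun hi =>
    (measurableSet_le (h.measurable_arrival i) measurable_const).compl.union
      (h.measurable_mark i hi hB)

theorem IsMarkedArrivals.measurable_total (h : IsMarkedArrivals P r G τ ξ) (t : ℝ) :
    Measurable (total τ ξ t) := by
  refine Measurable.tsum fun i => ?_
  by_cases hi : 1 ≤ i
  · simp only [hi, true_and]
    exact Measurable.ite (measurableSet_le (h.measurable_arrival i) measurable_const)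
      (h.measurable_mark i hi) measurable_const
  · simp only [hi, false_and, if_false]
    exact measurable_const

/-- The exponential moments of the accumulated marks, on the event that all marks lie in `B`. -/
theorem IsMarkedArrivals.lintegral_exp_total [IsProbabilityMeasure P]
    (h : IsMarkedArrivals P r G τ ξ) (h0 : τ 0 = 0) (hr : 0 < r) {B : Set ℝ≥0}
    (hB : MeasurableSet B) {s : ℝ} (hs : IntegrableOn (fun z : ℝ≥0 => Real.exp (s * z)) B G)
    {t : ℝ} (ht : 0 ≤ t) :
    ∫⁻ ω in marksIn τ ξ B t, ENNReal.ofReal (Real.exp (s * total τ ξ t ω)) ∂P =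
      ENNReal.ofReal (Real.exp (t * cumulant r G B s)) := by
  set w : ℝ≥0 → ℝ≥0∞ := B.indicator fun z => ENNReal.ofReal (Real.exp (s * z)) with hw
  have hwm : Measurable w := Measurable.indicator (by fun_prop) hB
  have hint : ∫⁻ z, w z ∂G = ENNReal.ofReal (∫ z in B, Real.exp (s * z) ∂G) := by
    rw [hw, lintegral_indicator hB, ofReal_integral_eq_lintegral_ofReal hs
      (ae_of_all _ fun _ => Real.exp_nonneg _)]
  have hφ : 0 ≤ ∫ z in B, Real.exp (s * z) ∂G :=
    integral_nonneg fun _ => Real.exp_nonneg _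
  have key := h.tsum_setLIntegral_markWeight h0 hr hwm hφ hint ht
  have hae : (⋃ n, countEvent τ t n) =ᵐ[P] univ := by
    filter_upwards [h.ae_exists_countEvent h0 hr ht] with ω hω
    exact propext ⟨fun _ => trivial, fun _ => mem_iUnion.2 hω⟩
  rw [cumulant, ← key, ← lintegral_indicator (h.measurableSet_marksIn hB t), ← setLIntegral_univ,
    ← setLIntegral_congr hae, lintegral_iUnion₀
      (fun n => (h.measurableSet_countEvent t n).nullMeasurableSet) (h.ae_pairwise_disjoint t)]
  refine tsum_congr fun n => setLIntegral_congr_fun_ae (h.measurableSet_countEvent t n) ?_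
  filter_upwards [h.arrival_strictMono] with ω hm hω
  rw [hw, markWeight_indicator_exp hm hω]

end Moments

/-! ### The rate function -/

section Rate

variable {r : ℝ} {G : Measure ℝ≥0}

theorem integrable_exp_mono {s s' : ℝ} (hss : s ≤ s')
    (h : Integrable (fun z : ℝ≥0 => Real.exp (s' * z)) G) :
    Integrable (fun z : ℝ≥0 => Real.exp (s * z)) G := by
  refine h.mono' (by fun_prop) (ae_of_all _ fun z => ?_)
  rw [Real.norm_of_nonneg (Real.exp_nonneg _)]
  gcongr

theorem integrable_exp_of_nonpos [IsProbabilityMeasure G] {s : ℝ} (hs : s ≤ 0) :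
    Integrable (fun z : ℝ≥0 => Real.exp (s * z)) G :=
  integrable_exp_mono hs (by simp)

theorem integrable_exp_iff (s : ℝ) :
    Integrable (fun z : ℝ≥0 => Real.exp (s * z)) G ↔
      ∫⁻ z : ℝ≥0, ENNReal.ofReal (Real.exp (s * z)) ∂G ≠ ∞ := by
  rw [← lt_top_iff_ne_top, ← hasFiniteIntegral_iff_ofReal (ae_of_all _ fun _ => Real.exp_nonneg _)]
  exact ⟨fun h => h.2, fun h => ⟨by fun_prop, h⟩⟩

theorem integrable_exp_of_lt_expBound [IsProbabilityMeasure G] {s : ℝ}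
    (hs : (s : EReal) < expBound G) : Integrable (fun z : ℝ≥0 => Real.exp (s * z)) G := by
  rcases le_or_gt s 0 with h | h
  · exact integrable_exp_of_nonpos h
  · rw [integrable_exp_iff]
    intro htop
    exact absurd (iInf₂_le (f := fun (s : ℝ) (_ : 0 < s ∧
      ∫⁻ z : ℝ≥0, ENNReal.ofReal (Real.exp (s * z)) ∂G = ∞) => (s : EReal)) s ⟨h, htop⟩)
      (not_le.2 hs)

theorem le_expBound_of_integrable {s : ℝ}
    (hs : Integrable (fun z : ℝ≥0 => Real.exp (s * z)) G) : (s : EReal) ≤ expBound G := by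
  refine le_iInf₂ fun s' hs' => EReal.coe_le_coe_iff.2 ?_
  by_contra hcon
  exact (integrable_exp_iff s').1 (integrable_exp_mono (not_le.1 hcon).le hs) hs'.2

theorem mul_integral_exp_sub_one [IsProbabilityMeasure G] {s : ℝ}
    (hs : Integrable (fun z : ℝ≥0 => Real.exp (s * z)) G) :
    r * ∫ z : ℝ≥0, (Real.exp (s * z) - 1) ∂G = cumulant r G univ s := by
  rw [integral_sub hs (integrable_const 1)]
  simp [cumulant]

theorem cumulant_mono (hr : 0 < r) {s s' : ℝ} (hss : s ≤ s') {B : Set ℝ≥0}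
    (h : IntegrableOn (fun z : ℝ≥0 => Real.exp (s' * z)) B G) :
    cumulant r G B s ≤ cumulant r G B s' := by
  unfold cumulant
  gcongr ?_ * (?_ - 1)
  refine integral_mono (integrable_exp_mono hss h) h fun z => ?_
  beta_reduce
  gcongr

theorem cumulant_zero [IsProbabilityMeasure G] : cumulant r G univ 0 = 0 := by
  simp [cumulant]

theorem rightLim_distFun_zero [IsProbabilityMeasure G] :
    Function.rightLim (distFun G) 0 = G.real {0} := by
  refine rightLim_eq_of_tendsto ?_
  have hI : ⋂ u > (0 : ℝ≥0), Iic u = {0} := by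
    ext z
    simp only [mem_iInter, mem_Iic, mem_singleton_iff]
    refine ⟨fun h => le_antisymm (le_of_forall_pos_le_add fun ε hε => ?_) bot_le, fun h u _ => ?_⟩
    · simpa using h ε hε
    · simp [h]
  have := tendsto_measure_biInter_gt (μ := G) (s := fun u : ℝ≥0 => Iic u) (a := 0)
    (fun _ _ => measurableSet_Iic.nullMeasurableSet) (fun _ _ _ h => Iic_subset_Iic.2 h)
    ⟨1, one_pos, measure_ne_top _ _⟩
  rw [hI] at this
  exact (ENNReal.tendsto_toReal (measure_ne_top G {0})).comp this

theorem rate_zero [IsProbabilityMeasure G] :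
    rate r G 0 = ((r * (1 - G.real {0}) : ℝ) : EReal) := by
  rw [rate, if_pos rfl, rightLim_distFun_zero]

/-- As `s → -∞` only the mass at `0` contributes to the cumulant. -/
theorem tendsto_cumulant_atBot [IsProbabilityMeasure G] :
    Tendsto (cumulant r G univ) atBot (𝓝 (r * (G.real {0} - 1))) := by
  unfold cumulant
  refine (Tendsto.sub_const ?_ 1).const_mul r
  have hlim : G.real {0} = ∫ z, ({0} : Set ℝ≥0).indicator (fun _ => (1 : ℝ)) z ∂G := by
    rw [integral_indicator_const _ (measurableSet_singleton 0)]; simp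
  rw [hlim, Measure.restrict_univ]
  refine tendsto_integral_filter_of_dominated_convergence (fun _ => 1)
    (Eventually.of_forall fun s => by fun_prop) ?_ (integrable_const 1) (ae_of_all _ fun z => ?_)
  · filter_upwards [eventually_le_atBot 0] with s hs
    refine ae_of_all _ fun z => ?_
    rw [Real.norm_of_nonneg (Real.exp_nonneg _), Real.exp_le_one_iff]
    exact mul_nonpos_of_nonpos_of_nonneg hs z.2
  · rcases eq_or_ne z 0 with rfl | hz
    · simp
    · rw [indicator_of_notMem (by simpa using hz)]
      exact Real.tendsto_exp_atBot.comp
        (tendsto_id.atBot_mul_const (by exact_mod_cast pos_iff_ne_zero.2 hz))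

/-- The affine functions `u ↦ su - K(s)` minorize the rate function, also for `s = Λ` if the
exponential moment at `Λ` is finite, and also at `u = 0`. -/
theorem sub_cumulant_le_rate [IsProbabilityMeasure G] (hr : 0 < r) {s : ℝ}
    (hs : Integrable (fun z : ℝ≥0 => Real.exp (s * z)) G) (u : ℝ≥0) :
    ((s * u - cumulant r G univ s : ℝ) : EReal) ≤ rate r G u := by
  rcases eq_or_ne u 0 with rfl | hu
  · rw [rate_zero, EReal.coe_le_coe_iff]
    have h1 : r * (G.real {0} - 1) ≤ cumulant r G univ s := by
      refine le_of_tendsto tendsto_cumulant_atBot ?_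
      filter_upwards [eventually_le_atBot s] with s' hs'
      exact cumulant_mono hr hs' (by simpa using hs)
    simp only [NNReal.coe_zero, mul_zero]
    linarith
  · have hlt : ∀ s' < s, ((s' * u - cumulant r G univ s : ℝ) : EReal) ≤ rate r G u := by
      intro s' hs'
      have hb : (s' : EReal) < expBound G :=
        (EReal.coe_lt_coe_iff.2 hs').trans_le (le_expBound_of_integrable hs)
      rw [rate, if_neg hu]
      refine le_trans ?_ (le_iSup₂_of_le s' hb le_rfl)
      rw [mul_integral_exp_sub_one (integrable_exp_mono hs'.le hs), EReal.coe_le_coe_iff]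
      have := cumulant_mono (r := r) (G := G) (B := univ) hr hs'.le (by simpa using hs)
      linarith
    have ht : Tendsto (fun s' : ℝ => ((s' * u - cumulant r G univ s : ℝ) : EReal)) (𝓝[<] s)
        (𝓝 ((s * u - cumulant r G univ s : ℝ) : EReal)) := by
      refine Tendsto.mono_left ?_ nhdsWithin_le_nhds
      refine (continuous_coe_real_ereal.comp ?_).tendsto s
      fun_prop
    exact le_of_tendsto ht (eventually_nhdsWithin_of_forall hlt)

/-- Conversely these affine functions exhaust the rate function. -/
theorem exists_lt_sub_cumulant [IsProbabilityMeasure G] {c : ℝ} {u : ℝ≥0}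
    (hc : (c : EReal) < rate r G u) :
    ∃ s : ℝ, Integrable (fun z : ℝ≥0 => Real.exp (s * z)) G ∧
      c < s * u - cumulant r G univ s := by
  rcases eq_or_ne u 0 with rfl | hu
  · rw [rate_zero, EReal.coe_lt_coe_iff] at hc
    have h1 : r * (G.real {0} - 1) < -c := by linarith
    obtain ⟨s, hs1, hs2⟩ := ((tendsto_cumulant_atBot.eventually (gt_mem_nhds h1)).and
      (eventually_le_atBot 0)).exists
    refine ⟨s, integrable_exp_of_nonpos hs2, ?_⟩
    simp only [NNReal.coe_zero, mul_zero]
    linarith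
  · rw [rate, if_neg hu] at hc
    obtain ⟨s, hs⟩ := lt_iSup_iff.1 hc
    obtain ⟨hb, hs⟩ := lt_iSup_iff.1 hs
    have hi := integrable_exp_of_lt_expBound hb
    rw [mul_integral_exp_sub_one hi, EReal.coe_lt_coe_iff] at hs
    exact ⟨s, hi, hs⟩

theorem rate_nonneg [IsProbabilityMeasure G] (hr : 0 < r) (u : ℝ≥0) : 0 ≤ rate r G u := by
  have := sub_cumulant_le_rate (G := G) hr (s := 0) (integrable_exp_of_nonpos le_rfl) u
  simpa [cumulant_zero] using this

theorem lowerSemicontinuous_rate [IsProbabilityMeasure G] (hr : 0 < r) :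
    LowerSemicontinuous (rate r G) := by
  intro u y hy
  obtain ⟨c, hyc, hc⟩ := EReal.lt_iff_exists_real_btwn.1 hy
  obtain ⟨s, hs, hlt⟩ := exists_lt_sub_cumulant hc
  have hcont : Continuous fun v : ℝ≥0 => s * (v : ℝ) - cumulant r G univ s := by fun_prop
  filter_upwards [hcont.continuousAt.eventually (lt_mem_nhds hlt)] with v hv
  exact (hyc.trans (EReal.coe_lt_coe_iff.2 hv)).trans_le (sub_cumulant_le_rate hr hs v)

theorem isGoodRate_rate [IsProbabilityMeasure G] (hr : 0 < r) (hΛ : 0 < expBound G) :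
    IsGoodRate (rate r G) := by
  intro c
  obtain ⟨s, hs0, hs⟩ := EReal.lt_iff_exists_real_btwn.1 hΛ
  have hs0 : 0 < s := by exact_mod_cast hs0
  refine (isCompact_Icc (a := (0 : ℝ≥0))
    (b := ((c + cumulant r G univ s) / s).toNNReal)).of_isClosed_subset
    ((lowerSemicontinuous_rate hr).isClosed_preimage _) fun u hu => ⟨bot_le, ?_⟩
  have := (sub_cumulant_le_rate hr (integrable_exp_of_lt_expBound hs) u).trans hu
  rw [EReal.coe_le_coe_iff] at this
  refine NNReal.le_toNNReal_of_coe_le ?_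
  rw [le_div_iff₀ hs0]
  linarith

end Rate

/-! ### The upper bound -/

section Upper

/-- Exponential estimates of the form `a e^{-ct}` have exponential rate `-c`. -/
theorem tendsto_log_mul_exp {a : ℝ} (ha : 0 < a) (c : ℝ) :
    Tendsto (fun t : ℝ≥0 => ((1 / (t : ℝ) : ℝ) : EReal) *
      ENNReal.log (ENNReal.ofReal (a * Real.exp (-(t * c))))) atTop (𝓝 (-(c : EReal))) := by
  have h1 : Tendsto (fun t : ℝ≥0 => Real.log a / (t : ℝ) - c) atTop (𝓝 (-c)) := by
    have := (Tendsto.div_atTop (tendsto_const_nhds (x := Real.log a))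
      (NNReal.tendsto_coe_atTop.2 tendsto_id)).sub_const c
    simpa using this
  have h2 := (continuous_coe_real_ereal.tendsto (-c)).comp h1
  rw [EReal.coe_neg] at h2
  refine h2.congr' ?_
  filter_upwards [eventually_gt_atTop 0] with t ht
  have ht' : (t : ℝ) ≠ 0 := by exact_mod_cast ht.ne'
  rw [ENNReal.log_ofReal_of_pos (by positivity), Real.log_mul ha.ne' (Real.exp_ne_zero _),
    Real.log_exp, ← EReal.coe_mul, Function.comp, EReal.coe_eq_coe_iff]
  field_simp
  ring

theorem limsup_log_le {p : ℝ≥0 → ℝ≥0∞} {a c : ℝ} (ha : 0 < a)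
    (h : ∀ᶠ t : ℝ≥0 in atTop, p t ≤ ENNReal.ofReal (a * Real.exp (-(t * c)))) :
    limsup (fun t : ℝ≥0 => ((1 / (t : ℝ) : ℝ) : EReal) * ENNReal.log (p t)) atTop ≤
      -(c : EReal) := by
  rw [← (tendsto_log_mul_exp ha c).limsup_eq]
  refine limsup_le_limsup ?_
  filter_upwards [h] with t ht
  exact mul_le_mul_of_nonneg_left (ENNReal.log_monotone ht)
    (EReal.coe_nonneg.2 (by positivity))

theorem le_liminf_log {p : ℝ≥0 → ℝ≥0∞} {a c : ℝ} (ha : 0 < a)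
    (h : ∀ᶠ t : ℝ≥0 in atTop, ENNReal.ofReal (a * Real.exp (-(t * c))) ≤ p t) :
    -(c : EReal) ≤
      liminf (fun t : ℝ≥0 => ((1 / (t : ℝ) : ℝ) : EReal) * ENNReal.log (p t)) atTop := by
  rw [← (tendsto_log_mul_exp ha c).liminf_eq]
  refine liminf_le_liminf ?_
  filter_upwards [h] with t ht
  exact mul_le_mul_of_nonneg_left (ENNReal.log_monotone ht)
    (EReal.coe_nonneg.2 (by positivity))

/-- A bound for all the lower half-lines with endpoint in `A` bounds the measure of `A`. -/
theorem measure_le_of_forall_Iic {α : Type*} [LinearOrder α] [TopologicalSpace α]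
    [OrderTopology α] [SecondCountableTopology α] [MeasurableSpace α] (ν : Measure α) {A : Set α}
    {C : ℝ≥0∞} (h : ∀ u ∈ A, ν (Iic u) ≤ C) : ν A ≤ C := by
  by_cases hmax : ∃ u ∈ A, ∀ v ∈ A, v ≤ u
  · obtain ⟨u, hu, hm⟩ := hmax
    exact (measure_mono fun v hv => hm v hv).trans (h u hu)
  · push Not at hmax
    -- without a greatest element, the open half-lines cover `A`, and countably many of them do
    obtain ⟨D, hDA, hDc, hD⟩ := TopologicalSpace.isOpen_biUnion_countable A (fun u => Iio u)
      fun _ _ => isOpen_Iio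
    have hsub : A ⊆ ⋃ u ∈ D, Iio u := by
      rw [hD]
      intro u hu
      obtain ⟨v, hv, huv⟩ := hmax u hu
      exact mem_iUnion₂.2 ⟨v, hv, huv⟩
    refine (measure_mono hsub).trans ?_
    rw [measure_biUnion_eq_iSup hDc]
    · exact iSup₂_le fun u hu => (measure_mono Iio_subset_Iic_self).trans (h u (hDA hu))
    · intro u hu v hv
      rcases le_total u v with huv | huv
      · exact ⟨v, hv, Iio_subset_Iio huv, subset_rfl⟩
      · exact ⟨u, hu, subset_rfl, Iio_subset_Iio huv⟩

theorem measure_le_of_forall_Ici {α : Type*} [LinearOrder α] [TopologicalSpace α]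
    [OrderTopology α] [SecondCountableTopology α] [MeasurableSpace α] (ν : Measure α) {A : Set α}
    {C : ℝ≥0∞} (h : ∀ u ∈ A, ν (Ici u) ≤ C) : ν A ≤ C :=
  measure_le_of_forall_Iic (α := αᵒᵈ) ν h

variable {Ω : Type*} {ξ : ℕ → Ω → ℝ≥0} {τ : ℕ → Ω → ℝ}

theorem coe_total_eq_mul_avg {t : ℝ≥0} (ht : 0 < t) (ω : Ω) :
    (total τ ξ t ω : ℝ) = t * avg τ ξ t ω := by
  rw [avg_eq, NNReal.coe_mul, NNReal.coe_inv, ← mul_assoc, mul_inv_cancel₀, one_mul]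
  exact_mod_cast ht.ne'

variable [mΩ : MeasurableSpace Ω] {P : Measure Ω} {r : ℝ} {G : Measure ℝ≥0}

theorem IsMarkedArrivals.measurable_avg (h : IsMarkedArrivals P r G τ ξ) (t : ℝ≥0) :
    Measurable (avg τ ξ t) :=
  (h.measurable_total t).const_mul _

/-- Chernoff's bound, for the law tilted by `e^{sY}`: changing `s` to `s'` gains `e^{-ta}` on an
event where `(s' - s) S_t ≥ a`. -/
theorem IsMarkedArrivals.setLIntegral_exp_total_le [IsProbabilityMeasure P]
    (h : IsMarkedArrivals P r G τ ξ) (h0 : τ 0 = 0) (hr : 0 < r) {B : Set ℝ≥0}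
    (hB : MeasurableSet B) (s : ℝ) {s' : ℝ}
    (hs' : IntegrableOn (fun z : ℝ≥0 => Real.exp (s' * z)) B G) {t : ℝ≥0} (ht : 0 < t)
    {A : Set Ω} {a : ℝ} (hA : ∀ ω ∈ A, a ≤ (s' - s) * avg τ ξ t ω) :
    ∫⁻ ω in A ∩ marksIn τ ξ B t, ENNReal.ofReal (Real.exp (s * total τ ξ t ω)) ∂P ≤
      ENNReal.ofReal (Real.exp (t * (cumulant r G B s' - a))) := by
  have hm := h.measurable_total (t : ℝ)
  calc ∫⁻ ω in A ∩ marksIn τ ξ B t, ENNReal.ofReal (Real.exp (s * total τ ξ t ω)) ∂P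
      ≤ ∫⁻ ω in A ∩ marksIn τ ξ B t, ENNReal.ofReal (Real.exp (-(t * a))) *
          ENNReal.ofReal (Real.exp (s' * total τ ξ t ω)) ∂P := by
        refine setLIntegral_mono (by fun_prop) fun ω hω => ?_
        rw [← ENNReal.ofReal_mul (Real.exp_nonneg _), ← Real.exp_add]
        refine ENNReal.ofReal_le_ofReal (Real.exp_le_exp.2 ?_)
        rw [coe_total_eq_mul_avg ht]
        have := mul_le_mul_of_nonneg_left (hA ω hω.1) t.coe_nonneg
        linarith
    _ ≤ ENNReal.ofReal (Real.exp (-(t * a))) *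
          ∫⁻ ω in marksIn τ ξ B t, ENNReal.ofReal (Real.exp (s' * total τ ξ t ω)) ∂P := by
        rw [lintegral_const_mul' _ _ ENNReal.ofReal_ne_top]
        gcongr
        exact inter_subset_right
    _ = _ := by
        rw [h.lintegral_exp_total h0 hr hB hs' t.coe_nonneg, ← ENNReal.ofReal_mul (Real.exp_nonneg _),
          ← Real.exp_add]
        congr 2
        ring

theorem IsMarkedArrivals.measure_le_exp [IsProbabilityMeasure P]
    (h : IsMarkedArrivals P r G τ ξ) (h0 : τ 0 = 0) (hr : 0 < r) {s : ℝ}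
    (hs : Integrable (fun z : ℝ≥0 => Real.exp (s * z)) G) {t : ℝ≥0} (ht : 0 < t)
    {A : Set Ω} {a : ℝ} (hA : ∀ ω ∈ A, a ≤ s * avg τ ξ t ω) :
    P A ≤ ENNReal.ofReal (Real.exp (-(t * (a - cumulant r G univ s)))) := by
  have := h.setLIntegral_exp_total_le h0 hr MeasurableSet.univ 0 (hs.integrableOn (s := univ)) ht
    (A := A) (a := a) (by simpa using hA)
  have e : marksIn τ ξ univ (t : ℝ) = univ := by simp [marksIn]
  rw [e, inter_univ] at this
  simp only [zero_mul, Real.exp_zero, ENNReal.ofReal_one, lintegral_one,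
    Measure.restrict_apply_univ] at this
  refine this.trans_eq ?_
  congr 2
  ring

/-- If the rate function exceeds `c` at a point of `F`, then `c < su - K(s)` for some `s`, and that
point is the endpoint of a half-line of probability at most `e^{-tc}`, an upper one if `s ≥ 0` and a
lower one if `s ≤ 0`. The factor `2` counts the two kinds. -/
theorem IsMarkedArrivals.measure_avg_mem_le [IsProbabilityMeasure P]
    (h : IsMarkedArrivals P r G τ ξ) (h0 : τ 0 = 0) (hr : 0 < r) {F : Set ℝ≥0}
    (hF : MeasurableSet F) {c : ℝ} (hc : ∀ u ∈ F, (c : EReal) < rate r G u) {t : ℝ≥0}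
    (ht : 0 < t) :
    P {ω | avg τ ξ t ω ∈ F} ≤ ENNReal.ofReal (2 * Real.exp (-(t * c))) := by
  have hG := h.isProbabilityMeasure
  have hm := h.measurable_avg t
  set ν := P.map (avg τ ξ t)
  set C := ENNReal.ofReal (Real.exp (-(t * c)))
  have hC : ∀ {s : ℝ} {u : ℝ≥0}, c < s * u - cumulant r G univ s →
      ENNReal.ofReal (Real.exp (-(t * (s * u - cumulant r G univ s)))) ≤ C := by
    intro s u hlt
    refine ENNReal.ofReal_le_ofReal (Real.exp_le_exp.2 (neg_le_neg ?_))
    gcongr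
  have h1 : ν {u | u ∈ F ∧ ∃ s : ℝ, 0 ≤ s ∧ Integrable (fun z : ℝ≥0 => Real.exp (s * z)) G ∧
      c < s * u - cumulant r G univ s} ≤ C := by
    refine measure_le_of_forall_Ici ν ?_
    rintro u ⟨_, s, hs0, hs, hlt⟩
    rw [Measure.map_apply hm measurableSet_Ici]
    refine (h.measure_le_exp h0 hr hs ht (a := s * u) fun ω hω => ?_).trans (hC hlt)
    exact mul_le_mul_of_nonneg_left (NNReal.coe_le_coe.2 hω) hs0
  have h2 : ν {u | u ∈ F ∧ ∃ s : ℝ, s ≤ 0 ∧ Integrable (fun z : ℝ≥0 => Real.exp (s * z)) G ∧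
      c < s * u - cumulant r G univ s} ≤ C := by
    refine measure_le_of_forall_Iic ν ?_
    rintro u ⟨_, s, hs0, hs, hlt⟩
    rw [Measure.map_apply hm measurableSet_Iic]
    refine (h.measure_le_exp h0 hr hs ht (a := s * u) fun ω hω => ?_).trans (hC hlt)
    exact mul_le_mul_of_nonpos_left (NNReal.coe_le_coe.2 hω) hs0
  have e : P {ω | avg τ ξ t ω ∈ F} = ν F := (Measure.map_apply hm hF).symm
  rw [e, two_mul, ENNReal.ofReal_add (Real.exp_nonneg _) (Real.exp_nonneg _)]
  refine le_trans (measure_mono ?_) ((measure_union_le _ _).trans (add_le_add h1 h2))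
  intro u hu
  obtain ⟨s, hs, hlt⟩ := exists_lt_sub_cumulant (hc u hu)
  rcases le_total 0 s with h' | h'
  · exact Or.inl ⟨hu, s, h', hs, hlt⟩
  · exact Or.inr ⟨hu, s, h', hs, hlt⟩

theorem IsMarkedArrivals.limsup_le [IsProbabilityMeasure P]
    (h : IsMarkedArrivals P r G τ ξ) (h0 : τ 0 = 0) (hr : 0 < r) {F : Set ℝ≥0}
    (hF : IsClosed F) :
    limsup (fun t : ℝ≥0 => ((1 / (t : ℝ) : ℝ) : EReal) *
      ENNReal.log (P {ω | avg τ ξ t ω ∈ F})) atTop ≤ -(⨅ u ∈ F, rate r G u) := by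
  rw [EReal.le_neg]
  refine EReal.ge_of_forall_gt_iff_ge.1 fun c hc => ?_
  rw [EReal.le_neg]
  refine limsup_log_le two_pos ?_
  filter_upwards [eventually_gt_atTop 0] with t ht
  exact h.measure_avg_mem_le h0 hr hF.measurableSet
    (fun u hu => hc.trans_le (iInf₂_le (f := fun u (_ : u ∈ F) => rate r G u) u hu)) ht

end Upper

/-! ### The cumulant of bounded marks -/

section Bounded

variable {r : ℝ} {G : Measure ℝ≥0}

theorem exists_measure_Ioc_ne_zero (h : G (Ioi 0) ≠ 0) : ∃ M : ℕ, G (Ioc 0 (M : ℝ≥0)) ≠ 0 := by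
  by_contra! hcon
  refine h (measure_mono_null ?_ (measure_iUnion_null hcon))
  intro z hz
  obtain ⟨M, hM⟩ := exists_nat_ge z
  exact mem_iUnion.2 ⟨M, hz, hM⟩

variable [IsProbabilityMeasure G]

theorem integrableOn_exp_Iic (M : ℝ≥0) (s : ℝ) :
    IntegrableOn (fun z : ℝ≥0 => Real.exp (s * z)) (Iic M) G := by
  have : Icc 0 M = Iic M := by ext; simp
  rw [← this]
  exact ContinuousOn.integrableOn_compact isCompact_Icc (by fun_prop)

theorem differentiable_cumulant_Iic (M : ℝ≥0) : Differentiable ℝ (cumulant r G (Iic M)) := by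
  intro s
  have hset : integrableExpSet (fun z : ℝ≥0 => (z : ℝ)) (G.restrict (Iic M)) = univ :=
    eq_univ_of_forall fun s => integrableOn_exp_Iic M s
  have := (hasDerivAt_mgf (X := fun z : ℝ≥0 => (z : ℝ)) (μ := G.restrict (Iic M)) (t := s)
    (by rw [hset, interior_univ]; trivial)).differentiableAt
  exact (this.sub_const 1).const_mul r

/-- If bounded marks are not all zero, then `su - K(s) → -∞` at both ends for `u > 0`. -/
theorem tendsto_sub_cumulant_cocompact (hr : 0 < r) {u : ℝ} (hu : 0 < u) {M : ℝ≥0}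
    (hM : G (Ioc 0 M) ≠ 0) :
    Tendsto (fun s : ℝ => cumulant r G (Iic M) s - s * u) (cocompact ℝ) atTop := by
  rw [cocompact_eq_atBot_atTop, tendsto_sup]
  constructor
  · refine tendsto_atTop_mono (f := fun s : ℝ => -r + s * (-u)) (fun s => ?_)
      (tendsto_atTop_add_const_left _ _ (tendsto_id.atBot_mul_const_of_neg (neg_lt_zero.2 hu)))
    have : 0 ≤ ∫ z in Iic M, Real.exp (s * z) ∂G := integral_nonneg fun _ => Real.exp_nonneg _
    have := mul_nonneg hr.le this
    simp only [cumulant]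
    linarith
  · have hsq : IntegrableOn (fun z : ℝ≥0 => (z : ℝ) ^ 2) (Iic M) G := by
      have : Icc 0 M = Iic M := by ext; simp
      rw [← this]
      exact ContinuousOn.integrableOn_compact isCompact_Icc (by fun_prop)
    set m := ∫ z in Iic M, (z : ℝ) ^ 2 ∂G with hm
    have hmpos : 0 < m := by
      rw [hm, setIntegral_pos_iff_support_of_nonneg_ae (ae_of_all _ fun z => by positivity) hsq]
      refine (pos_iff_ne_zero.2 hM).trans_le (measure_mono fun z hz => ⟨?_, hz.2⟩)
      have : (z : ℝ) ≠ 0 := by exact_mod_cast hz.1.ne'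
      simpa using this
    have hlim : Tendsto (fun s : ℝ => s * (r * m / 2 * s - u) + -r) atTop atTop := by
      refine tendsto_atTop_add_const_right _ _ (tendsto_id.atTop_mul_atTop₀ ?_)
      exact tendsto_atTop_add_const_right _ _ (tendsto_id.const_mul_atTop (by positivity))
    refine tendsto_atTop_mono' _ ?_ hlim
    filter_upwards [eventually_ge_atTop 0] with s hs
    -- quadratic growth, from `x ^ 2 / 2 ≤ exp x`, already beats the linear term
    have hle : s ^ 2 / 2 * m ≤ ∫ z in Iic M, Real.exp (s * z) ∂G := by
      rw [hm, ← integral_const_mul]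
      refine integral_mono (hsq.const_mul _) (integrableOn_exp_Iic M s) fun z => ?_
      have hsz : 0 ≤ s * z := mul_nonneg hs z.2
      have := Real.quadratic_le_exp_of_nonneg hsz
      beta_reduce
      nlinarith
    have := mul_le_mul_of_nonneg_left hle hr.le
    simp only [cumulant]
    linarith

theorem exists_maximizer (hr : 0 < r) {u : ℝ} (hu : 0 < u) {M : ℝ≥0} (hM : G (Ioc 0 M) ≠ 0) :
    ∃ s, HasDerivAt (cumulant r G (Iic M)) u s ∧
      ∀ s', s' * u - cumulant r G (Iic M) s' ≤ s * u - cumulant r G (Iic M) s := by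
  have hd := differentiable_cumulant_Iic (r := r) (G := G) M
  have hcont : Continuous fun s : ℝ => cumulant r G (Iic M) s - s * u :=
    hd.continuous.sub (by fun_prop)
  obtain ⟨s, hs⟩ := hcont.exists_forall_le (tendsto_sub_cumulant_cocompact hr hu hM)
  refine ⟨s, ?_, fun s' => by linarith [hs s']⟩
  have hder := (hd s).hasDerivAt
  have hmin : IsLocalMin (fun s : ℝ => cumulant r G (Iic M) s - s * u) s :=
    Eventually.of_forall hs
  have h0 := hmin.hasDerivAt_eq_zero (hder.sub ((hasDerivAt_id s).mul_const u))
  rw [one_mul, sub_eq_zero] at h0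
  rwa [h0] at hder

/-- If the truncated integrals are bounded, then so is the full one. -/
theorem integrable_exp_of_bounded {s b : ℝ}
    (h : ∀ᶠ M : ℕ in atTop, ∫ z in Iic (M : ℝ≥0), Real.exp (s * z) ∂G ≤ b) :
    Integrable (fun z : ℝ≥0 => Real.exp (s * z)) G ∧ ∫ z : ℝ≥0, Real.exp (s * z) ∂G ≤ b := by
  have hcov : AECover G atTop fun M : ℕ => Iic (M : ℝ≥0) :=
    aecover_Iic tendsto_natCast_atTop_atTop
  have hint : Integrable (fun z : ℝ≥0 => Real.exp (s * z)) G :=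
    hcov.integrable_of_integral_bounded_of_nonneg_ae b (fun M => integrableOn_exp_Iic _ s)
      (ae_of_all _ fun _ => Real.exp_nonneg _) h
  exact ⟨hint, le_of_tendsto (hcov.integral_tendsto_of_countably_generated hint) h⟩

/-- Truncation of the marks does not change the rate function in the limit. The suprema for the
truncated marks decrease as the truncation level grows; their superlevel sets are compact, hence
have a common point as long as they are nonempty, and such a point bounds the rate function from
below. -/
theorem exists_truncation (hr : 0 < r) {u : ℝ≥0} (hu : 0 < u) {l : ℝ}
    (hl : rate r G u < (l : EReal)) :
    ∃ (M : ℝ≥0) (s : ℝ), HasDerivAt (cumulant r G (Iic M)) (u : ℝ) s ∧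
      s * u - cumulant r G (Iic M) s < l := by
  have hu' : (0 : ℝ) < u := hu
  have hbound : ∀ s : ℝ, Integrable (fun z : ℝ≥0 => Real.exp (s * z)) G →
      s * u - cumulant r G univ s < l := fun s hs =>
    EReal.coe_lt_coe_iff.1 ((sub_cumulant_le_rate hr hs u).trans_lt hl)
  by_cases hG : G (Ioi 0) = 0
  · -- all marks vanish, the cumulant is zero and `rate r G u = ⊤`
    exfalso
    have hae : (fun z : ℝ≥0 => Real.exp (l / u * z)) =ᵐ[G] fun _ => 1 := by
      refine measure_mono_null (fun z hz => ?_) hG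
      rw [mem_Ioi, pos_iff_ne_zero]
      rintro rfl
      exact hz (by simp)
    have := hbound (l / u) ((integrable_const 1).congr hae.symm)
    rw [cumulant, Measure.restrict_univ, integral_congr_ae hae] at this
    simp [div_mul_cancel₀ _ hu'.ne'] at this
  obtain ⟨M₀, hM₀⟩ := exists_measure_Ioc_ne_zero hG
  have hMn : ∀ n : ℕ, G (Ioc 0 ((M₀ + n : ℕ) : ℝ≥0)) ≠ 0 := fun n h =>
    hM₀ (measure_mono_null (Ioc_subset_Ioc_right (by push_cast; exact le_self_add)) h)
  by_contra! hcon
  set C : ℕ → Set ℝ := fun n =>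
    {s | l ≤ s * u - cumulant r G (Iic ((M₀ + n : ℕ) : ℝ≥0)) s} with hC
  have hcont : ∀ n : ℕ, Continuous fun s : ℝ =>
      s * u - cumulant r G (Iic ((M₀ + n : ℕ) : ℝ≥0)) s := fun n =>
    Continuous.sub (by fun_prop) (differentiable_cumulant_Iic _).continuous
  have hclosed : ∀ n, IsClosed (C n) := fun n => isClosed_le continuous_const (hcont n)
  have hcompact : IsCompact (C 0) := by
    -- the superlevel set is bounded, as the objective tends to `-∞` at both ends
    have := (tendsto_sub_cumulant_cocompact hr hu' (hMn 0)).eventually (eventually_gt_atTop (-l))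
    obtain ⟨K, hK, hsub⟩ := mem_cocompact.1 this
    refine hK.of_isClosed_subset (hclosed 0) fun s hs => ?_
    by_contra hsK
    have h1 : -l < cumulant r G (Iic ((M₀ + 0 : ℕ) : ℝ≥0)) s - s * u := hsub hsK
    have h2 : l ≤ s * u - cumulant r G (Iic ((M₀ + 0 : ℕ) : ℝ≥0)) s := hs
    linarith
  have hanti : ∀ n, C (n + 1) ⊆ C n := by
    intro n s hs
    have hs' : l ≤ s * u - cumulant r G (Iic ((M₀ + (n + 1) : ℕ) : ℝ≥0)) s := hs
    refine hs'.trans (sub_le_sub_left ?_ _)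
    unfold cumulant
    gcongr r * (?_ - 1)
    refine setIntegral_mono_set (integrableOn_exp_Iic _ s) (ae_of_all _ fun _ => Real.exp_nonneg _)
      (Iic_subset_Iic.2 ?_).eventuallyLE
    push_cast
    gcongr
    exact le_self_add
  have hne : ∀ n, (C n).Nonempty := by
    intro n
    obtain ⟨s, hs, _⟩ := exists_maximizer hr hu' (hMn n)
    exact ⟨s, hcon _ s hs⟩
  obtain ⟨s, hs⟩ := IsCompact.nonempty_iInter_of_sequence_nonempty_isCompact_isClosed C hanti hne
    hcompact hclosed
  have hev : ∀ᶠ M : ℕ in atTop, ∫ z in Iic (M : ℝ≥0), Real.exp (s * z) ∂G ≤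
      (s * u - l) / r + 1 := by
    filter_upwards [eventually_ge_atTop M₀] with M hM
    obtain ⟨n, rfl⟩ := Nat.exists_eq_add_of_le hM
    have : l ≤ s * u - cumulant r G (Iic ((M₀ + n : ℕ) : ℝ≥0)) s := mem_iInter.1 hs n
    rw [cumulant] at this
    rw [← sub_le_iff_le_add, le_div_iff₀ hr]
    linarith
  obtain ⟨hint, hle⟩ := integrable_exp_of_bounded hev
  have h1 := hbound s hint
  rw [cumulant, Measure.restrict_univ] at h1
  rw [← sub_le_iff_le_add, le_div_iff₀ hr] at hle
  linarith

end Bounded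

/-! ### The lower bound -/

section Lower

variable {Ω : Type*} {ξ : ℕ → Ω → ℝ≥0} {τ : ℕ → Ω → ℝ}
  [mΩ : MeasurableSpace Ω] {P : Measure Ω} {r : ℝ} {G : Measure ℝ≥0} [IsProbabilityMeasure P]

/-- The lower bound near a point `u` where `su - K(s)` is stationary: under the law tilted by
`e^{sY}`, the average concentrates at `u` exponentially fast, by Chernoff's bound with parameters
slightly larger and slightly smaller than `s`. -/
theorem IsMarkedArrivals.eventually_exp_le (h : IsMarkedArrivals P r G τ ξ) (h0 : τ 0 = 0)
    (hr : 0 < r) {B : Set ℝ≥0} (hB : MeasurableSet B)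
    (hint : ∀ s : ℝ, IntegrableOn (fun z : ℝ≥0 => Real.exp (s * z)) B G) {s u : ℝ}
    (hder : HasDerivAt (cumulant r G B) u s) {δ : ℝ} (hδ : 0 < δ) :
    ∀ᶠ t : ℝ≥0 in atTop,
      ENNReal.ofReal (1 / 2 * Real.exp (-(t * (s * u - cumulant r G B s + |s| * δ)))) ≤
        P {ω | |(avg τ ξ t ω : ℝ) - u| < δ} := by
  set k := cumulant r G B with hk
  have hev : ∀ᶠ x in 𝓝 s, k x ≤ k s + (x - s) * u + δ / 2 * |x - s| := by
    have := (hasDerivAt_iff_isLittleO.1 hder).def (half_pos hδ)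
    filter_upwards [this] with x hx
    have := (le_abs_self _).trans hx
    rw [smul_eq_mul, Real.norm_eq_abs] at this
    linarith
  obtain ⟨ε, hε, hball⟩ := Metric.eventually_nhds_iff.1 hev
  have hplus := @hball (s + ε / 2) (by
    rw [Real.dist_eq, add_sub_cancel_left, abs_of_pos] <;> linarith)
  have hminus := @hball (s - ε / 2) (by
    rw [Real.dist_eq, abs_of_neg] <;> linarith)
  rw [add_sub_cancel_left, abs_of_pos (half_pos hε)] at hplus
  rw [sub_sub_cancel_left, abs_of_neg (by linarith : -(ε / 2) < 0)] at hminus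
  -- each tail of the tilted law has mass at most `e^{-tη}` relative to the total mass `e^{t k(s)}`
  set η := ε / 2 * (δ / 2) with hη
  have hηpos : 0 < η := by positivity
  have hsmall : ∀ᶠ t : ℝ≥0 in atTop, Real.exp (-(t * η)) < 1 / 4 := by
    have : Tendsto (fun t : ℝ≥0 => Real.exp (-(t * η))) atTop (𝓝 0) :=
      Real.tendsto_exp_neg_atTop_nhds_zero.comp
        ((NNReal.tendsto_coe_atTop.2 tendsto_id).atTop_mul_const hηpos)
    exact this.eventually (gt_mem_nhds (by norm_num))
  filter_upwards [hsmall, eventually_gt_atTop 0] with t hsm ht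
  set E := marksIn τ ξ B (t : ℝ) with hE
  set f : Ω → ℝ≥0∞ := fun ω => ENNReal.ofReal (Real.exp (s * total τ ξ t ω)) with hf
  set A₀ := {ω | |(avg τ ξ t ω : ℝ) - u| < δ} with hA₀
  set A₁ := {ω | u + δ ≤ (avg τ ξ t ω : ℝ)} with hA₁
  set A₂ := {ω | (avg τ ξ t ω : ℝ) ≤ u - δ} with hA₂
  have hmass : ∫⁻ ω in E, f ω ∂P = ENNReal.ofReal (Real.exp (t * k s)) :=
    h.lintegral_exp_total h0 hr hB (hint s) t.coe_nonneg
  have hcover : E ⊆ A₀ ∩ E ∪ (A₁ ∩ E ∪ A₂ ∩ E) := by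
    intro ω hω
    by_cases h1 : u + δ ≤ (avg τ ξ t ω : ℝ)
    · exact Or.inr (Or.inl ⟨h1, hω⟩)
    by_cases h2 : (avg τ ξ t ω : ℝ) ≤ u - δ
    · exact Or.inr (Or.inr ⟨h2, hω⟩)
    have h3 : |(avg τ ξ t ω : ℝ) - u| < δ := by
      rw [abs_lt]; constructor <;> linarith
    exact Or.inl ⟨h3, hω⟩
  have hsplit : ∫⁻ ω in E, f ω ∂P ≤
      ∫⁻ ω in A₀ ∩ E, f ω ∂P + (∫⁻ ω in A₁ ∩ E, f ω ∂P + ∫⁻ ω in A₂ ∩ E, f ω ∂P) :=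
    (lintegral_mono_set hcover).trans <| (lintegral_union_le _ _ _).trans <|
      add_le_add le_rfl (lintegral_union_le _ _ _)
  have hb1 : ∫⁻ ω in A₁ ∩ E, f ω ∂P ≤ ENNReal.ofReal (Real.exp (t * (k s - η))) := by
    refine (h.setLIntegral_exp_total_le h0 hr hB s (hint (s + ε / 2)) ht
      (a := ε / 2 * (u + δ)) fun ω hω => ?_).trans (ENNReal.ofReal_le_ofReal ?_)
    · rw [add_sub_cancel_left]
      exact mul_le_mul_of_nonneg_left hω (half_pos hε).le
    · refine Real.exp_le_exp.2 (mul_le_mul_of_nonneg_left ?_ t.coe_nonneg)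
      rw [← hk, hη]
      linarith
  have hb2 : ∫⁻ ω in A₂ ∩ E, f ω ∂P ≤ ENNReal.ofReal (Real.exp (t * (k s - η))) := by
    refine (h.setLIntegral_exp_total_le h0 hr hB s (hint (s - ε / 2)) ht
      (a := -(ε / 2) * (u - δ)) fun ω hω => ?_).trans (ENNReal.ofReal_le_ofReal ?_)
    · rw [sub_sub_cancel_left]
      exact mul_le_mul_of_nonpos_left hω (by linarith)
    · refine Real.exp_le_exp.2 (mul_le_mul_of_nonneg_left ?_ t.coe_nonneg)
      rw [← hk, hη]
      linarith
  have hb0 : ∫⁻ ω in A₀ ∩ E, f ω ∂P ≤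
      ENNReal.ofReal (Real.exp (t * (s * u + |s| * δ))) * P A₀ := by
    calc ∫⁻ ω in A₀ ∩ E, f ω ∂P
        ≤ ∫⁻ _ in A₀ ∩ E, ENNReal.ofReal (Real.exp (t * (s * u + |s| * δ))) ∂P := by
          refine setLIntegral_mono measurable_const fun ω hω => ?_
          refine ENNReal.ofReal_le_ofReal (Real.exp_le_exp.2 ?_)
          rw [coe_total_eq_mul_avg ht, mul_left_comm]
          refine mul_le_mul_of_nonneg_left ?_ t.coe_nonneg
          have h1 : s * (avg τ ξ t ω - u) ≤ |s| * δ := by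
            refine (le_abs_self _).trans ?_
            rw [abs_mul]
            exact mul_le_mul_of_nonneg_left (le_of_lt hω.1) (abs_nonneg s)
          linarith
      _ ≤ _ := by
          rw [setLIntegral_const]
          gcongr
          exact inter_subset_left
  have htot := hmass.symm.le.trans (hsplit.trans (add_le_add hb0 (add_le_add hb1 hb2)))
  have hp : P A₀ = ENNReal.ofReal (P.real A₀) := (ofReal_measureReal).symm
  rw [hp, ← ENNReal.ofReal_mul (Real.exp_nonneg _),
    ← ENNReal.ofReal_add (Real.exp_nonneg _) (Real.exp_nonneg _),
    ← ENNReal.ofReal_add (by positivity) (by positivity),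
    ENNReal.ofReal_le_ofReal_iff (by positivity)] at htot
  rw [hp]
  refine ENNReal.ofReal_le_ofReal ?_
  have e1 : Real.exp (t * (k s - η)) = Real.exp (t * k s) * Real.exp (-(t * η)) := by
    rw [← Real.exp_add]; ring_nf
  have e2 : Real.exp (-(t * (s * u - k s + |s| * δ))) =
      Real.exp (t * k s) / Real.exp (t * (s * u + |s| * δ)) := by
    rw [← Real.exp_sub]; ring_nf
  have hpos := Real.exp_pos (t * k s)
  have hmul := mul_lt_mul_of_pos_left hsm hpos
  rw [e1] at htot
  rw [e2, ← mul_div_assoc, div_le_iff₀ (Real.exp_pos _)]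
  linarith

/-- The probability that all marks up to time `t` vanish. -/
theorem IsMarkedArrivals.exp_le_measure_avg_eq_zero (h : IsMarkedArrivals P r G τ ξ)
    (h0 : τ 0 = 0) (hr : 0 < r) (t : ℝ≥0) :
    ENNReal.ofReal (Real.exp (-(t * (r * (1 - G.real {0}))))) ≤ P {ω | avg τ ξ t ω = 0} := by
  have hG := h.isProbabilityMeasure
  have key := h.lintegral_exp_total h0 hr (measurableSet_singleton (0 : ℝ≥0)) (s := 0)
    (by simp) t.coe_nonneg
  simp only [zero_mul, Real.exp_zero, ENNReal.ofReal_one, lintegral_one,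
    Measure.restrict_apply_univ, cumulant, integral_const, smul_eq_mul, mul_one,
    measureReal_restrict_apply_univ] at key
  have e : -((t : ℝ) * (r * (1 - G.real {0}))) = t * (r * (G.real {0} - 1)) := by ring
  rw [e, ← key]
  refine measure_mono fun ω hω => ?_
  have : total τ ξ t ω = 0 := by
    refine (tsum_congr fun i => ?_).trans tsum_zero
    split_ifs with hi
    · exact hω i hi.1 hi.2
    · rfl
  simp [avg_eq, this]

theorem IsMarkedArrivals.le_liminf_of_rate_lt (h : IsMarkedArrivals P r G τ ξ) (h0 : τ 0 = 0)
    (hr : 0 < r) {O : Set ℝ≥0} (hO : IsOpen O) {u : ℝ≥0} (hu : u ∈ O) {l : ℝ}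
    (hl : rate r G u < (l : EReal)) :
    -(l : EReal) ≤ liminf (fun t : ℝ≥0 => ((1 / (t : ℝ) : ℝ) : EReal) *
      ENNReal.log (P {ω | avg τ ξ t ω ∈ O})) atTop := by
  have hG := h.isProbabilityMeasure
  rcases eq_or_ne u 0 with rfl | hu0
  · rw [rate_zero, EReal.coe_lt_coe_iff] at hl
    refine le_liminf_log one_pos (Eventually.of_forall fun t => ?_)
    rw [one_mul]
    calc ENNReal.ofReal (Real.exp (-(t * l)))
        ≤ ENNReal.ofReal (Real.exp (-(t * (r * (1 - G.real {0}))))) := by gcongr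
      _ ≤ P {ω | avg τ ξ t ω = 0} := h.exp_le_measure_avg_eq_zero h0 hr t
      _ ≤ _ := measure_mono fun ω hω => by
          change avg τ ξ t ω = 0 at hω
          change avg τ ξ t ω ∈ O
          rwa [hω]
  · obtain ⟨M, s, hder, hlt⟩ := exists_truncation hr (pos_iff_ne_zero.2 hu0) hl
    obtain ⟨ρ, hρ, hball⟩ := Metric.isOpen_iff.1 hO u hu
    set g := s * u - cumulant r G (Iic M) s with hg
    -- the neighbourhood lies in `O`, and the oscillation `|s| δ` of the tilt stays below `l - g`
    set δ := min ρ ((l - g) / (|s| + 1)) with hδ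
    have hs1 : 0 < |s| + 1 := by positivity
    have hδpos : 0 < δ := lt_min hρ (div_pos (sub_pos.2 hlt) hs1)
    have hδle : g + |s| * δ ≤ l := by
      have h1 : δ * (|s| + 1) ≤ l - g := (le_div_iff₀ hs1).1 (min_le_right _ _)
      linarith
    refine le_liminf_log (a := 1 / 2) (by norm_num) ?_
    filter_upwards [h.eventually_exp_le h0 hr measurableSet_Iic (integrableOn_exp_Iic M) hder hδpos]
      with t ht
    refine le_trans (ENNReal.ofReal_le_ofReal ?_) (ht.trans (measure_mono fun ω hω => ?_))
    · gcongr
    · refine hball ?_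
      rw [Metric.mem_ball, NNReal.dist_eq]
      exact lt_of_lt_of_le hω (min_le_left _ _)

theorem IsMarkedArrivals.le_liminf (h : IsMarkedArrivals P r G τ ξ) (h0 : τ 0 = 0)
    (hr : 0 < r) {O : Set ℝ≥0} (hO : IsOpen O) :
    -(⨅ u ∈ O, rate r G u) ≤ liminf (fun t : ℝ≥0 => ((1 / (t : ℝ) : ℝ) : EReal) *
      ENNReal.log (P {ω | avg τ ξ t ω ∈ O})) atTop := by
  rw [EReal.neg_le]
  refine le_iInf₂ fun u hu => EReal.le_of_forall_lt_iff_le.1 fun l hl => ?_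
  rw [EReal.neg_le]
  exact h.le_liminf_of_rate_lt h0 hr hO hu hl

end Lower
end MarkedPoisson

theorem theorem2 {Ω : Type*} [MeasurableSpace Ω] (P : Measure Ω) [IsProbabilityMeasure P]
    (r : ℝ) (hr : 0 < r) (G : Measure ℝ≥0) (τ : ℕ → Ω → ℝ) (ξ : ℕ → Ω → ℝ≥0)
    (h : MarkedPoisson.IsMarkedArrivals P r G τ ξ) :
    MarkedPoisson.SatisfiesLDP P atTop (fun t : ℝ≥0 => 1 / (t : ℝ))
        (MarkedPoisson.avg τ ξ) (MarkedPoisson.rate r G) ∧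
      (0 < MarkedPoisson.expBound G → MarkedPoisson.IsGoodRate (MarkedPoisson.rate r G)) := by
  have hG := h.isProbabilityMeasure
  have h' := h.update_zero
  have h0 : Function.update τ 0 0 0 = 0 := Function.update_self ..
  rw [← MarkedPoisson.avg_update_zero]
  exact ⟨⟨MarkedPoisson.rate_nonneg hr, MarkedPoisson.lowerSemicontinuous_rate hr,
    fun _ hF => h'.limsup_le h0 hr hF, fun _ hO => h'.le_liminf h0 hr hO⟩,
    MarkedPoisson.isGoodRate_rate hr⟩
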